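/- **Setting.** Let $(\mathcal X,d)$ be a locally compact separable metric space, let $\partial$ be the point added in its one-point compactification, and let $X=(X_t,\mathcal G_t,\mathbb P_x)$ be a Hunt process on $\mathcal X$ with cemetery $\partial$ (Borel measurable laws, right continuous paths with left limits in $\mathcal X\cup\{\partial\}$, $\partial$ a trap, $\mathcal G_t$ the minimal augmented admissible filtration, strong Markov and quasi-left-continuous); put $X_\infty:=\partial$. Assume that there is a kernel $J(x,dy)$ of $\sigma$-finite measures on $\mathcal X\setminus\{x\}$ such that $(J(x,dy),t)$ is a Lévy system of $X$: for every Borel $f\ge 0$ on $[0,\infty)\times\mathcal X\times\mathcal X$ that vanishes on the diagonal of $\mathcal X\times\mathcal X$ (extended by $0$ to $\partial$), every $(\mathcal G_t)$-stopping time $T$ and every $x\in\mathcal X$, $$\mathbb E_x\sum_{s\le T}f(s,X_{s-},X_s)=\mathbb E_x\int_0^T\int_{\mathcal X}f(s,X_s,y)\,J(X_s,dy)\,ds .$$ For $D\subset\mathcal X$ let $\tau_D=\inf\{t\ge 0: X_t\notin D\}$, let $B(\xi,r)$ be the open ball, and $B_D(\xi,r)=D\cap B(\xi,r)$. Let $\phi:[0,\infty)\to[0,\infty)$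 be strictly increasing with $\phi(0)=0$, $\phi(1)=1$ and $$\frac{\phi(R)}{\phi(r)}\le c\Big(\frac Rr\Big)^{\beta}\qquad\text{for all }0<r\le R<\infty, \tag{1}$$ where $c\ge 1$ and $\beta>0$ (such $c,\beta$ exist if and only if $\phi$ is doubling). **Proposition 3.1.** Let $r_0,\bar r\in(0,\infty]$ and $C_{E},C_{J}\in(0,\infty)$, and assume * $(\mathrm{EP})_{\phi,r_0,\le}$: $\ \mathbb P_x(\tau_{B(x,r)}<t)\le C_E\,t/\phi(r)$ for all $t>0$, $x\in\mathcal X$ and $r\in(0,r_0)$; * $(\mathrm{Jt})_{\phi,\bar r,\le}$: $\ J(x,B(x,r)^c)\le C_J/\phi(r)$ for all $x\in\mathcal X$ and $r\in(0,\bar r)$. Then there is a constant $C\in[1,\infty)$, depending only on $C_E$, $C_J$, $c$ and $\beta$, such that for every open $D\subset\mathcal X$, every $\xi\in\mathcal X$, every $r\in(0,r_0\wedge\bar r)$ and every $x\in B_D(\xi,r/2)$, $$\mathbb P_x\big(X_{\tau_{B_D(\xi,r)}}\in D\big)=\mathbb P_x\big(\tau_D>\tau_{B_D(\xi,r)}\big)\le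 C\,\frac{\mathbb E_x[\tau_{B_D(\xi,r)}]}{\phi(r)} .$$ -/

import Mathlib

open MeasureTheory ProbabilityTheory Filter Topology
open scoped NNReal ENNReal

universe u v

namespace HuntBHP

noncomputable section

/-- The one-point compactification `𝒳 ∪ {∂}` of the state space, with `∂ = ∞`, carries its Borel
σ-algebra. (If `𝒳` is compact, `∂` is an isolated point.) -/
instance onePointMeasurableSpace (𝒳 : Type u) [TopologicalSpace 𝒳] :
    MeasurableSpace (OnePoint 𝒳) := borel (OnePoint 𝒳)

instance onePointBorelSpace (𝒳 : Type u) [TopologicalSpace 𝒳] : BorelSpace (OnePoint 𝒳) := ⟨rfl⟩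

/-- The raw data of a time-homogeneous Markov family with state space `𝒳` and cemetery `∂ = ∞`:
the coordinates `X t`, the shifts `θ t`, and the laws `P x` of the process started at `x`,
depending on `x` in a Borel measurable way. -/
structure ProcessData (𝒳 : Type u) [TopologicalSpace 𝒳] (Ω : Type v) [MeasurableSpace Ω] where
  /-- the position at time `t` -/
  X : ℝ≥0 → Ω → OnePoint 𝒳
  /-- the time shifts -/
  θ : ℝ≥0 → Ω → Ω
  /-- the law of the process started at `x` -/
  P : Kernel (OnePoint 𝒳) Ω

namespace ProcessData

variable {𝒳 : Type u} [TopologicalSpace 𝒳] {Ω : Type v} [MeasurableSpace Ω]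

/-- The law `P_μ = ∫ P_x μ(dx)` of the process with initial distribution `μ`. -/
def law (Y : ProcessData 𝒳 Ω) (μ : Measure (OnePoint 𝒳)) : Measure Ω := μ.bind Y.P

/-- The raw past `σ(X_s : s ≤ t)`. -/
abbrev past (Y : ProcessData 𝒳 Ω) (t : ℝ≥0) : MeasurableSpace Ω :=
  ⨆ s : Set.Iic t, MeasurableSpace.comap (Y.X s) inferInstance

/-- The minimal augmented admissible filtration: `A` belongs to `𝒢_t` when, for every initial
probability distribution `μ`, it agrees up to a `P_μ`-null set with an event of the raw past. -/
abbrev filtration (Y : ProcessData 𝒳 Ω) (t : ℝ≥0) : MeasurableSpace Ω where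
  MeasurableSet' A := ∀ μ : Measure (OnePoint 𝒳), IsProbabilityMeasure μ →
    ∃ B : Set Ω, MeasurableSet[Y.past t] B ∧ A =ᵐ[Y.law μ] B
  measurableSet_empty := fun _ _ => ⟨∅, @MeasurableSet.empty _ (Y.past t), ae_eq_rfl⟩
  measurableSet_compl := fun A hA μ hμ => by
    obtain ⟨B, hB, hAB⟩ := hA μ hμ
    exact ⟨Bᶜ, MeasurableSet.compl (m := Y.past t) hB, hAB.compl⟩
  measurableSet_iUnion := fun A hA μ hμ => by
    choose B hB hAB using fun n => hA n μ hμ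
    exact ⟨⋃ n, B n, MeasurableSet.iUnion (m := Y.past t) hB, Filter.EventuallyEq.countable_iUnion hAB⟩

/-- `[0, ∞]`-valued stopping times of the augmented filtration. -/
def IsStopping (Y : ProcessData 𝒳 Ω) (T : Ω → ℝ≥0∞) : Prop :=
  ∀ t : ℝ≥0, MeasurableSet[Y.filtration t] {ω | T ω ≤ t}

open Classical in
/-- The position `X_T` at a random time `T`, with `X_∞ = ∂`. -/
def stopped (Y : ProcessData 𝒳 Ω) (T : Ω → ℝ≥0∞) (ω : Ω) : OnePoint 𝒳 :=
  if T ω = ⊤ then OnePoint.infty else Y.X (T ω).toNNReal ω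

/-- The first exit time `τ_D = inf {t ≥ 0 : X_t ∉ D}` (with `inf ∅ = ∞`). The cemetery is not
in `D`, so `τ_D` is at most the lifetime. -/
def exitTime (Y : ProcessData 𝒳 Ω) (D : Set 𝒳) (ω : Ω) : ℝ≥0∞ :=
  ⨅ (t : ℝ≥0) (_ : Y.X t ω ∉ ((↑) : 𝒳 → OnePoint 𝒳) '' D), (t : ℝ≥0∞)

/-- Hunt processes on `𝒳` (for `𝒳` locally compact, separable and metrizable). -/
structure IsHunt (Y : ProcessData 𝒳 Ω) : Prop where
  /-- the `P x` are probability measures on the σ-algebra generated by the process -/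
  isMarkovKernel : IsMarkovKernel Y.P
  generated : (inferInstance : MeasurableSpace Ω) =
    ⨆ t : ℝ≥0, MeasurableSpace.comap (Y.X t) inferInstance
  /-- the process starts at `x` under `P x` -/
  normal : ∀ x, ∀ᵐ ω ∂(Y.P x), Y.X 0 ω = x
  /-- the cemetery is a trap -/
  trap : ∀ ω s t, s ≤ t → Y.X s ω = OnePoint.infty → Y.X t ω = OnePoint.infty
  shift : ∀ s t ω, Y.X s (Y.θ t ω) = Y.X (s + t) ω
  /-- paths are right continuous -/
  right_cont : ∀ ω t, ContinuousWithinAt (fun s => Y.X s ω) (Set.Ici t) t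
  /-- paths have left limits in `𝒳 ∪ {∂}` -/
  left_lim : ∀ ω t, 0 < t → ∃ z, Tendsto (fun s => Y.X s ω) (𝓝[<] t) (𝓝 z)
  /-- the augmented filtration is right continuous -/
  filtration_right_cont : ∀ (t : ℝ≥0) (A : Set Ω),
    (∀ s, t < s → MeasurableSet[Y.filtration s] A) → MeasurableSet[Y.filtration t] A
  /-- strong Markov property: `P_μ(θ_T ∈ Λ | 𝒢_T) = P_{X_T}(Λ)` on `{T < ∞}` -/
  strong_markov : ∀ (μ : Measure (OnePoint 𝒳)), IsProbabilityMeasure μ →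
    ∀ T : Ω → ℝ≥0∞, Y.IsStopping T →
    ∀ A : Set Ω, (∀ t : ℝ≥0, MeasurableSet[Y.filtration t] (A ∩ {ω | T ω ≤ t})) →
    ∀ Λ : Set Ω, MeasurableSet Λ →
      Y.law μ (A ∩ {ω | T ω < ⊤} ∩ {ω | Y.θ (T ω).toNNReal ω ∈ Λ}) =
        ∫⁻ ω in A ∩ {ω | T ω < ⊤}, Y.P (Y.stopped T ω) Λ ∂(Y.law μ)
  /-- quasi-left-continuity: if `T_n ↑ T`, then `X_{T_n} → X_T` almost surely on `{T < ∞}` -/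
  quasi_left_cont : ∀ (μ : Measure (OnePoint 𝒳)), IsProbabilityMeasure μ →
    ∀ T : ℕ → Ω → ℝ≥0∞, (∀ n, Y.IsStopping (T n)) → Monotone T →
      ∀ᵐ ω ∂(Y.law μ), (⨆ n, T n ω) < ⊤ →
        Tendsto (fun n => Y.stopped (T n) ω) atTop
          (𝓝 (Y.stopped (fun ω' => ⨆ n, T n ω') ω))

/-- `(J(x, dy), t)` is a Lévy system of the process: `J` is a kernel of σ-finite measures, `J x`
lives on `𝒳 \ {x}`, and
`E_x ∑_{s ≤ T} f(s, X_{s-}, X_s) = E_x ∫_0^T ∫ f(s, X_s, y) J(X_s, dy) ds` for all Borel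
`f ≥ 0` on `[0, ∞) × 𝒳 × 𝒳` vanishing on the diagonal of `𝒳 × 𝒳` and all stopping times `T`.
Functions on `𝒳` are extended by `0` to `∂`; `leftLim` at time `0` is the value at time `0`, so
that no jump is counted there. -/
def IsLevySystem [MeasurableSpace 𝒳] (Y : ProcessData 𝒳 Ω) (J : Kernel 𝒳 𝒳) : Prop :=
  (∀ x, SigmaFinite (J x)) ∧ (∀ x, J x {x} = 0) ∧
  ∀ f : ℝ≥0 × 𝒳 × 𝒳 → ℝ≥0∞, Measurable f → (∀ s x, f (s, x, x) = 0) →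
    ∀ T : Ω → ℝ≥0∞, Y.IsStopping T → ∀ x : 𝒳,
      ∫⁻ ω, ∑' s : {s : ℝ≥0 // (s : ℝ≥0∞) ≤ T ω},
          (Function.leftLim (fun t => Y.X t ω) s.1).elim 0
            (fun y => (Y.X s.1 ω).elim 0 (fun z => f (s.1, y, z))) ∂(Y.P x) =
        ∫⁻ ω, (∫⁻ s in {s : ℝ | 0 ≤ s ∧ ENNReal.ofReal s ≤ T ω},
          (Y.X s.toNNReal ω).elim 0
            (fun y => ∫⁻ z, f (s.toNNReal, y, z) ∂(J y)) ∂(volume : Measure ℝ)) ∂(Y.P x)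

end ProcessData

/-- The scale functions: strictly increasing `φ : [0, ∞) → [0, ∞)` with `φ 0 = 0`, `φ 1 = 1` and
`φ(R) / φ(r) ≤ c (R / r) ^ β` for `0 < r ≤ R`, an equivalent form of the doubling property
`φ(2r) ≤ C φ(r)` that names its parameters `c` and `β`. -/
structure IsScale (φ : ℝ≥0 → ℝ≥0) (c : ℝ≥0) (β : ℝ) : Prop where
  strictMono : StrictMono φ
  map_zero : φ 0 = 0
  map_one : φ 1 = 1
  growth : ∀ r R : ℝ≥0, 0 < r → r ≤ R → φ R / φ r ≤ c * (R / r) ^ β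

/-- The exit probability bound with constant `C`: `P_x(τ_{B(x,r)} < t) ≤ C t / φ(r)` for all
`t > 0`, `x ∈ 𝒳` and `r ∈ (0, r₀)`. -/
def ExitProbUpper {𝒳 : Type u} [MetricSpace 𝒳] {Ω : Type v} [MeasurableSpace Ω]
    (Y : ProcessData 𝒳 Ω) (φ : ℝ≥0 → ℝ≥0) (r₀ : ℝ≥0∞) (C : ℝ≥0) : Prop :=
  ∀ t : ℝ≥0, 0 < t → ∀ (x : 𝒳) (r : ℝ≥0), 0 < r → (r : ℝ≥0∞) < r₀ →
    Y.P x {ω | Y.exitTime (Metric.ball x r) ω < t} ≤ (C : ℝ≥0∞) * (t / φ r)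

/-- The upper jump tail bound with constant `C`: `J(x, B(x,r)ᶜ) ≤ C / φ(r)` for all `x ∈ 𝒳` and
`r ∈ (0, r̄)`. -/
def JumpTailUpper {𝒳 : Type u} [MetricSpace 𝒳] [MeasurableSpace 𝒳]
    (J : Kernel 𝒳 𝒳) (φ : ℝ≥0 → ℝ≥0) (rbar : ℝ≥0∞) (C : ℝ≥0) : Prop :=
  ∀ (x : 𝒳) (r : ℝ≥0), 0 < r → (r : ℝ≥0∞) < rbar →
    J x (Metric.ball x r)ᶜ ≤ (C : ℝ≥0∞) / φ r

end

end HuntBHP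

/-! Write `U = D ∩ B(ξ, r)`. The proof is an iteration: for every `n` and every `z ∈ D`, `P_z(τ_U <
τ_D) ≤ Γ_n(z) + K E_z[τ_U]`, where `K = const / φ(r)` does not depend on `n`. The weight `Γ_n`
(`shellWeight`) is at least `1` on `D` for `n = 0`, and equals `γ^{-n}` at points of `D ∩ B(ξ,
r/2)`. Letting `n → ∞` at such a point leaves only `K E_x[τ_U]`.

To pass from `n` to `n + 1` at `z ∈ D ∩ B(ξ, r_{n+1})`, let `T` be the exit time from `W = D ∩ B(z,
r/2^{n+3}) ⊆ U` and use the strong Markov property at `T`. Since `E_z[T] + E_z[E_{X_T}[τ_U]; T < ∞]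
≤ E_z[τ_U]` (`IsHunt.lintegral_exitTime_add_le`), any contribution to `E_z[Γ_n(X_T)]` of size `K
E_z[T]` is absorbed without enlarging `K`. It remains to show `E_z[Γ_n(X_T)] ≤ γ^{-(n+1)} + K
E_z[T]`. The part `γ^{-n} P_z(X_T ∈ D)` is handled by the exit probability bound for times before a
level `t` and by Markov's inequality for later times. Landing outside `B(ξ, r_j)` requires a jump
longer than about `r/2^{j+3}`, with probability at most `C_J E_z[T] / φ(r/2^{j+3})` by the Lévy
system. The weights `γ^{1-j}` with `γ = 2 · 2^β` beat the growth of `φ(r)/φ(r/2^{j+3})`, so the sum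
over shells converges.

Exit times are not assumed measurable. Quasi-left-continuity supplies measurable stopping times
almost surely equal to them (`IsHunt.exists_isStopping_ae_eq_exitTime`). -/

namespace HuntBHP

/-! ### Topology of the one-point compactification -/

section Topology

variable {𝒳 : Type u} [TopologicalSpace 𝒳]

/-- A countable base of `𝒳` serves the finite points, and the complements of a compact exhaustion
serve `∞`. This yields metrizability of the compactification, on which the measurability and
approximation arguments rest. -/
instance onePoint_secondCountable [T2Space 𝒳] [WeaklyLocallyCompactSpace 𝒳]
    [SecondCountableTopology 𝒳] : SecondCountableTopology (OnePoint 𝒳) := by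
  have : LocallyCompactSpace 𝒳 := inferInstance
  have : SigmaCompactSpace 𝒳 := inferInstance
  let K : CompactExhaustion 𝒳 := CompactExhaustion.choice 𝒳
  let b := TopologicalSpace.countableBasis 𝒳
  let B : Set (Set (OnePoint 𝒳)) :=
    ((fun s : Set 𝒳 => ((↑) : 𝒳 → OnePoint 𝒳) '' s) '' b) ∪
      Set.range fun n => (((↑) : 𝒳 → OnePoint 𝒳) '' (K n))ᶜ
  have hB : TopologicalSpace.IsTopologicalBasis B := by
    refine TopologicalSpace.isTopologicalBasis_of_isOpen_of_nhds ?_ ?_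
    · rintro s (⟨t, ht, rfl⟩ | ⟨n, rfl⟩)
      · exact OnePoint.isOpen_image_coe.2 (TopologicalSpace.isOpen_of_mem_countableBasis ht)
      · exact OnePoint.isOpen_compl_image_coe.2 ⟨(K.isCompact n).isClosed, K.isCompact n⟩
    · intro a s ha hs
      induction a using OnePoint.rec with
      | infty =>
        obtain ⟨-, hc⟩ := (OnePoint.isOpen_iff_of_mem ha).1 hs
        obtain ⟨n, hn⟩ := K.exists_superset_of_isCompact hc
        refine ⟨_, Or.inr ⟨n, rfl⟩, by simp, ?_⟩
        intro y hy
        induction y using OnePoint.rec with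
        | infty => exact ha
        | coe y =>
          by_contra h
          exact hy ⟨y, hn h, rfl⟩
      | coe x =>
        have hs' : IsOpen (((↑) : 𝒳 → OnePoint 𝒳) ⁻¹' s) := hs.preimage OnePoint.continuous_coe
        obtain ⟨t, ht, hxt, hts⟩ :=
          (TopologicalSpace.isBasis_countableBasis 𝒳).exists_subset_of_mem_open
            (show x ∈ ((↑) : 𝒳 → OnePoint 𝒳) ⁻¹' s from ha) hs'
        exact ⟨_, Or.inl ⟨t, ht, rfl⟩, ⟨x, hxt, rfl⟩, Set.image_subset_iff.2 hts⟩
  exact hB.secondCountableTopology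
    (((TopologicalSpace.countable_countableBasis 𝒳).image _).union (Set.countable_range _))

/-- A closed set in a metrizable space has a decreasing sequence of open neighbourhoods whose
closures shrink to it. -/
theorem exists_open_antitone_seq {E : Type*} [TopologicalSpace E]
    [TopologicalSpace.PseudoMetrizableSpace E] {F : Set E} (hF : IsClosed F) :
    ∃ O : ℕ → Set E, (∀ n, IsOpen (O n)) ∧ Antitone O ∧ (∀ n, F ⊆ O n) ∧
      ∀ (y : ℕ → E) (z : E), (∀ n, y n ∈ closure (O n)) → Tendsto y atTop (𝓝 z) → z ∈ F := by
  let _ := TopologicalSpace.pseudoMetrizableSpacePseudoMetric E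
  refine ⟨fun n => Metric.thickening (1 / ((n : ℝ) + 1)) F, fun n => Metric.isOpen_thickening,
    fun m n h => Metric.thickening_mono (one_div_le_one_div_of_le (by positivity)
      (by exact_mod_cast Nat.succ_le_succ h)) F,
    fun n => Metric.self_subset_thickening (by positivity) F, fun y z hy hz => ?_⟩
  have h1 : ∀ n, Metric.infEDist (y n) F ≤ ENNReal.ofReal (1 / ((n : ℝ) + 1)) := fun n =>
    Metric.closure_thickening_subset_cthickening _ _ (hy n)
  have h2 : Tendsto (fun n => Metric.infEDist (y n) F) atTop (𝓝 (Metric.infEDist z F)) :=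
    (Metric.continuous_infEDist.tendsto z).comp hz
  have h3 : Tendsto (fun n : ℕ => ENNReal.ofReal (1 / ((n : ℝ) + 1))) atTop (𝓝 0) := by
    simpa using ENNReal.tendsto_ofReal tendsto_one_div_add_atTop_nhds_zero_nat
  have h4 : Metric.infEDist z F = 0 := le_antisymm (le_of_tendsto_of_tendsto' h2 h3 h1) bot_le
  rw [← hF.closure_eq]
  exact Metric.mem_closure_iff_infEDist_zero.2 h4

end Topology

end HuntBHP

/-! ### Hitting times, and measurable versions of exit times -/

namespace HuntBHP

/-- For a right continuous process, the hitting time of an open set is determined before time `a`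
by the positions before time `a`. -/
theorem measurableSet_hitting_lt {E : Type*} [TopologicalSpace E] [MeasurableSpace E]
    [OpensMeasurableSpace E] {Ω : Type*} [MeasurableSpace Ω] {X : ℝ≥0 → Ω → E}
    (hX : ∀ ω t, ContinuousWithinAt (fun s => X s ω) (Set.Ici t) t)
    {O : Set E} (hO : IsOpen O) (a : ℝ≥0∞)
    (hm : ∀ t : ℝ≥0, (t : ℝ≥0∞) < a → Measurable (X t)) :
    MeasurableSet {ω | ⨅ (t : ℝ≥0) (_ : X t ω ∈ O), (t : ℝ≥0∞) < a} := by
  obtain ⟨s, hsc, hsd⟩ := TopologicalSpace.exists_countable_dense ℝ≥0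
  have : {ω | ⨅ (t : ℝ≥0) (_ : X t ω ∈ O), (t : ℝ≥0∞) < a} =
      ⋃ q ∈ {q | q ∈ s ∧ (q : ℝ≥0∞) < a}, X q ⁻¹' O := by
    ext ω
    simp only [Set.mem_ofPred_eq, iInf_lt_iff, Set.mem_iUnion, Set.mem_preimage, exists_prop]
    constructor
    · rintro ⟨t, htO, hta⟩
      obtain ⟨u, htu, hua⟩ := ENNReal.lt_iff_exists_nnreal_btwn.1 hta
      -- Right continuity keeps the path in `O` for a short while after `t`, so a time of the
      -- countable dense set can replace `t`.
      have hev : (fun t => X t ω) ⁻¹' O ∈ 𝓝[Set.Ici t] t := (hX ω t) (hO.mem_nhds htO)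
      obtain ⟨w, hw, hsw⟩ := (mem_nhdsGE_iff_exists_Ico_subset).1 hev
      obtain ⟨q, hqs, hq⟩ := hsd.exists_between
        (show t < min u w from lt_min (by exact_mod_cast htu) hw)
      refine ⟨q, ⟨hqs, lt_trans ?_ hua⟩, hsw ⟨hq.1.le, hq.2.trans_le (min_le_right _ _)⟩⟩
      exact_mod_cast hq.2.trans_le (min_le_left _ _)
    · rintro ⟨q, ⟨-, hqa⟩, hq⟩
      exact ⟨q, hq, hqa⟩
  rw [this]
  exact MeasurableSet.biUnion (hsc.mono fun q hq => hq.1) fun q hq => hm q hq.2 hO.measurableSet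

namespace ProcessData

variable {𝒳 : Type u} [TopologicalSpace 𝒳] {Ω : Type v} [MeasurableSpace Ω]
  {Y : ProcessData 𝒳 Ω}

/-- The hitting time of a subset of the compactified state space. -/
noncomputable def hitTime (Y : ProcessData 𝒳 Ω) (O : Set (OnePoint 𝒳)) (ω : Ω) : ℝ≥0∞ :=
  ⨅ (t : ℝ≥0) (_ : Y.X t ω ∈ O), (t : ℝ≥0∞)

theorem exitTime_eq_hitTime (D : Set 𝒳) (ω : Ω) :
    Y.exitTime D ω = Y.hitTime (((↑) : 𝒳 → OnePoint 𝒳) '' D)ᶜ ω := rfl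

theorem hitTime_lt_iff {O : Set (OnePoint 𝒳)} {ω : Ω} {a : ℝ≥0∞} :
    Y.hitTime O ω < a ↔ ∃ t : ℝ≥0, Y.X t ω ∈ O ∧ (t : ℝ≥0∞) < a := by
  simp [hitTime, iInf_lt_iff]

theorem hitTime_le {O : Set (OnePoint 𝒳)} {ω : Ω} {t : ℝ≥0} (h : Y.X t ω ∈ O) :
    Y.hitTime O ω ≤ t := iInf₂_le t h

theorem hitTime_anti {O O' : Set (OnePoint 𝒳)} (h : O ⊆ O') (ω : Ω) :
    Y.hitTime O' ω ≤ Y.hitTime O ω :=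
  le_iInf₂ fun _ ht => hitTime_le (h ht)

theorem stopped_of_eq {T : Ω → ℝ≥0∞} {ω : Ω} {t : ℝ≥0} (h : T ω = t) :
    Y.stopped T ω = Y.X t ω := by
  simp [stopped, h]

/-- Visits to `O` occur at, or arbitrarily soon after, the infimum, so right continuity puts the
position there in the closure. -/
theorem IsHunt.stopped_hitTime_mem_closure (hY : Y.IsHunt) {O : Set (OnePoint 𝒳)} {ω : Ω}
    (h : Y.hitTime O ω < ⊤) : Y.stopped (Y.hitTime O) ω ∈ closure O := by
  lift Y.hitTime O ω to ℝ≥0 using h.ne with s hs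
  rw [stopped_of_eq hs.symm]
  refine mem_closure_of_frequently_of_tendsto (b := 𝓝[Set.Ici s] s) ?_ (hY.right_cont ω s)
  intro hev
  obtain ⟨u, hu, hsu⟩ := (mem_nhdsGE_iff_exists_Ico_subset).1 hev
  have hlt : Y.hitTime O ω < (u : ℝ≥0∞) := by rw [← hs]; exact_mod_cast hu
  obtain ⟨t, htO, htu⟩ := hitTime_lt_iff.1 hlt
  have hst : s ≤ t := by
    have := hitTime_le htO
    rw [← hs] at this
    exact_mod_cast this
  exact hsu ⟨hst, by exact_mod_cast htu⟩ htO

theorem IsHunt.measurable_X (hY : Y.IsHunt) (t : ℝ≥0) : Measurable (Y.X t) := by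
  have hle : MeasurableSpace.comap (Y.X t) inferInstance ≤ ‹MeasurableSpace Ω› :=
    (le_iSup (fun t : ℝ≥0 => MeasurableSpace.comap (Y.X t) inferInstance) t).trans
      hY.generated.ge
  exact fun s hs => hle _ ⟨s, hs, rfl⟩

theorem past_le_filtration (s : ℝ≥0) : Y.past s ≤ Y.filtration s :=
  fun A hA _ _ => ⟨A, hA, ae_eq_rfl⟩

theorem measurable_past {s t : ℝ≥0} (h : s ≤ t) : Measurable[Y.past t] (Y.X s) := by
  intro A hA
  exact (le_iSup (fun s : Set.Iic t => MeasurableSpace.comap (Y.X s) inferInstance) ⟨s, h⟩) _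
    ⟨A, hA, rfl⟩

/-- Right continuity of the augmented filtration turns strict inequalities into weak ones; for open
sets only the strict events are visible in the raw past. -/
theorem IsHunt.isStopping_of_lt (hY : Y.IsHunt) {T : Ω → ℝ≥0∞}
    (hT : ∀ t : ℝ≥0, MeasurableSet[Y.past t] {ω | T ω < t}) : Y.IsStopping T := by
  intro t
  refine hY.filtration_right_cont t _ fun s hts => past_le_filtration s _ ?_
  obtain ⟨u, hu, hus, hut⟩ := exists_seq_strictAnti_tendsto' hts
  have : {ω | T ω ≤ t} = ⋂ n, {ω | T ω < u n} := by
    ext ω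
    simp only [Set.mem_ofPred_eq, Set.mem_iInter]
    refine ⟨fun h n => h.trans_lt (by exact_mod_cast (hus n).1), fun h => ?_⟩
    exact ge_of_tendsto' (ENNReal.tendsto_coe.2 hut) fun n => (h n).le
  rw [this]
  refine MeasurableSet.iInter fun n => ?_
  have hle : Y.past (u n) ≤ Y.past s := by
    refine iSup_le fun q => ?_
    exact le_iSup (fun s' : Set.Iic s => MeasurableSpace.comap (Y.X s') inferInstance)
      ⟨q.1, le_trans q.2 (hus n).2.le⟩
  exact hle _ (hT (u n))

theorem IsHunt.isStopping_hitTime (hY : Y.IsHunt) {O : Set (OnePoint 𝒳)} (hO : IsOpen O) :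
    Y.IsStopping (Y.hitTime O) :=
  hY.isStopping_of_lt fun t =>
    @measurableSet_hitting_lt (OnePoint 𝒳) _ _ _ Ω (Y.past t) Y.X hY.right_cont O hO t
      fun _ hs => measurable_past (by exact_mod_cast hs.le)

theorem IsHunt.measurable_hitTime (hY : Y.IsHunt) {O : Set (OnePoint 𝒳)} (hO : IsOpen O) :
    Measurable (Y.hitTime O) :=
  measurable_of_Iio fun a => measurableSet_hitting_lt hY.right_cont hO a fun t _ => hY.measurable_X t

/-- The exit time of an open set is almost surely equal, under every initial law, to a
measurable stopping time that is also bounded by each time at which the left limit is outside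
of the set. -/
theorem IsHunt.exists_isStopping_ae_eq_exitTime
    [TopologicalSpace.PseudoMetrizableSpace (OnePoint 𝒳)] (hY : Y.IsHunt) {W : Set 𝒳}
    (hW : IsOpen W) :
    ∃ T : Ω → ℝ≥0∞, Measurable T ∧ Y.IsStopping T ∧ (∀ ω, T ω ≤ Y.exitTime W ω) ∧
      (∀ μ : Measure (OnePoint 𝒳), IsProbabilityMeasure μ →
        ∀ᵐ ω ∂(Y.law μ), T ω = Y.exitTime W ω) ∧
      ∀ ω (t : ℝ≥0) z, 0 < t → Tendsto (fun s => Y.X s ω) (𝓝[<] t) (𝓝 z) →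
        z ∉ ((↑) : 𝒳 → OnePoint 𝒳) '' W → T ω ≤ t := by
  obtain ⟨O, hO, hanti, hsub, hlim⟩ :=
    exists_open_antitone_seq (OnePoint.isOpen_image_coe.2 hW).isClosed_compl
  -- The candidate is the limit of the hitting times of open neighbourhoods shrinking to the
  -- complement of `W`.
  refine ⟨fun ω => ⨆ n, Y.hitTime (O n) ω, Measurable.iSup fun n => hY.measurable_hitTime (hO n),
    ?_, fun ω => iSup_le fun n => hitTime_anti (hsub n) ω, ?_, ?_⟩
  · intro t
    have : {ω | ⨆ n, Y.hitTime (O n) ω ≤ t} = ⋂ n, {ω | Y.hitTime (O n) ω ≤ t} := by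
      ext ω; simp
    rw [this]
    exact MeasurableSet.iInter (m := Y.filtration t) fun n => hY.isStopping_hitTime (hO n) t
  · intro μ hμ
    filter_upwards [hY.quasi_left_cont μ hμ (fun n => Y.hitTime (O n))
      (fun n => hY.isStopping_hitTime (hO n)) (fun m n h ω => hitTime_anti (hanti h) ω)] with ω hω
    apply le_antisymm
    · exact iSup_le fun n => hitTime_anti (hsub n) ω
    · rcases eq_or_ne (⨆ n, Y.hitTime (O n) ω) ⊤ with h | h
      · rw [h]; exact le_top
      -- By quasi-left-continuity the positions at the approximating times converge to the position
      -- at their supremum. They lie in the closures of the `O n`, so the limit is outside `W` and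
      -- the exit has already occurred.
      have hz := hlim _ _ (fun n => hY.stopped_hitTime_mem_closure
        ((le_iSup (fun n => Y.hitTime (O n) ω) n).trans_lt h.lt_top)) (hω h.lt_top)
      lift (⨆ n, Y.hitTime (O n) ω) to ℝ≥0 using h with s hs
      rw [stopped_of_eq (T := fun ω => ⨆ n, Y.hitTime (O n) ω) (t := s) hs.symm] at hz
      exact hitTime_le hz
  · intro ω t z ht hz hzW
    refine iSup_le fun n => ?_
    have : NeBot (𝓝[<] t) := nhdsLT_neBot_of_exists_lt ⟨0, ht⟩
    obtain ⟨s, hs, hst⟩ := ((hz.eventually ((hO n).mem_nhds (hsub n hzW))).and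
      self_mem_nhdsWithin).exists
    exact (hitTime_le hs).trans (by exact_mod_cast le_of_lt hst)

end ProcessData

end HuntBHP

/-! ### Strong Markov property and the position at an exit time -/

namespace HuntBHP

/-- A right continuous process evaluated at a measurable random time is measurable. -/
theorem measurable_eval_of_rightCont {E : Type*} [TopologicalSpace E] [MeasurableSpace E]
    [BorelSpace E] [TopologicalSpace.PseudoMetrizableSpace E] {Ω : Type*} [MeasurableSpace Ω]
    {X : ℝ≥0 → Ω → E} (hX : ∀ ω t, ContinuousWithinAt (fun s => X s ω) (Set.Ici t) t)
    (hm : ∀ t, Measurable (X t)) {τ : Ω → ℝ≥0} (hτ : Measurable τ) :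
    Measurable fun ω => X (τ ω) ω := by
  have hcomp : ∀ (b : ℕ → ℝ≥0) (N : Ω → ℕ), Measurable N → Measurable fun ω => X (b (N ω)) ω := by
    intro b N hN
    have h1 : Measurable fun p : ℕ × Ω => X (b p.1) p.2 :=
      measurable_from_prod_countable_right fun n => hm (b n)
    exact h1.comp (hN.prodMk measurable_id)
  -- Grid points of mesh `1/(k+1)`; the `+ 1` in the numerator rounds upwards, so that the
  -- approximation comes from the right, where the paths are continuous.
  obtain ⟨b, hb⟩ : ∃ b : ℕ → ℕ → ℝ≥0, ∀ k n, b k n = ((n : ℝ≥0) + 1) / ((k : ℝ≥0) + 1) :=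
    ⟨_, fun _ _ => rfl⟩
  obtain ⟨a, ha⟩ : ∃ a : ℕ → ℝ≥0 → ℝ≥0, ∀ k s, a k s = b k ⌊((k : ℝ≥0) + 1) * s⌋₊ :=
    ⟨_, fun _ _ => rfl⟩
  have hle : ∀ k s, s ≤ a k s := fun k s => by
    rw [ha, hb, le_div_iff₀ (by positivity), mul_comm]
    exact (Nat.lt_floor_add_one _).le
  have hub : ∀ k s, a k s ≤ s + 1 / ((k : ℝ≥0) + 1) := fun k s => by
    have : s + 1 / ((k : ℝ≥0) + 1) = (((k : ℝ≥0) + 1) * s + 1) / ((k : ℝ≥0) + 1) := by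
      field_simp
    rw [this, ha, hb]
    exact div_le_div_of_nonneg_right (add_le_add_left (Nat.floor_le zero_le) 1) (by positivity)
  have hlim : ∀ s, Tendsto (fun k => a k s) atTop (𝓝 s) := fun s => by
    refine tendsto_of_tendsto_of_tendsto_of_le_of_le tendsto_const_nhds ?_ (fun k => hle k s)
      (fun k => hub k s)
    simpa using (tendsto_one_div_add_atTop_nhds_zero_nat (𝕜 := ℝ≥0)).const_add s
  refine measurable_of_tendsto_metrizable (f := fun k ω => X (a k (τ ω)) ω) (fun k => ?_) ?_
  · simp only [ha]
    exact hcomp (b k) _ (Nat.measurable_floor.comp (hτ.const_mul ((k : ℝ≥0) + 1)))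
  · refine tendsto_pi_nhds.2 fun ω => ?_
    exact (hX ω (τ ω)).tendsto.comp
      (tendsto_nhdsWithin_iff.2 ⟨hlim _, Eventually.of_forall fun k => hle k _⟩)

namespace ProcessData

section

variable {𝒳 : Type u} [TopologicalSpace 𝒳] {Ω : Type v} [MeasurableSpace Ω]
  {Y : ProcessData 𝒳 Ω}

theorem law_dirac (x : OnePoint 𝒳) : Y.law (Measure.dirac x) = Y.P x :=
  Measure.dirac_bind Y.P.measurable x

theorem IsHunt.measurable_shift [TopologicalSpace.PseudoMetrizableSpace (OnePoint 𝒳)]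
    (hY : Y.IsHunt) {τ : Ω → ℝ≥0} (hτ : Measurable τ) : Measurable fun ω => Y.θ (τ ω) ω := by
  have hle : (‹MeasurableSpace Ω› : MeasurableSpace Ω) ≤
      MeasurableSpace.map (fun ω => Y.θ (τ ω) ω) ‹MeasurableSpace Ω› := by
    refine hY.generated.le.trans (iSup_le fun s => ?_)
    have : Measurable fun ω => Y.X (s + τ ω) ω :=
      measurable_eval_of_rightCont hY.right_cont hY.measurable_X (hτ.const_add s)
    intro A hA
    obtain ⟨B, hB, rfl⟩ := hA
    change MeasurableSet ((fun ω => Y.X s (Y.θ (τ ω) ω)) ⁻¹' B)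
    simpa only [hY.shift] using this hB
  exact hle

/-- The strong Markov property for nonnegative functionals. -/
theorem IsHunt.lintegral_shift [TopologicalSpace.PseudoMetrizableSpace (OnePoint 𝒳)]
    (hY : Y.IsHunt) {T : Ω → ℝ≥0∞} (hT : Measurable T) (hTs : Y.IsStopping T) (x : OnePoint 𝒳)
    {F : Ω → ℝ≥0∞} (hF : Measurable F) :
    ∫⁻ ω in {ω | T ω < ⊤}, F (Y.θ (T ω).toNNReal ω) ∂(Y.P x) =
      ∫⁻ ω in {ω | T ω < ⊤}, ∫⁻ ω', F ω' ∂(Y.P (Y.X (T ω).toNNReal ω)) ∂(Y.P x) := by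
  have hset : MeasurableSet {ω | T ω < ⊤} := hT measurableSet_Iio
  have hθ : Measurable fun ω => Y.θ (T ω).toNNReal ω := hY.measurable_shift hT.ennreal_toNNReal
  have hX : Measurable fun ω => Y.X (T ω).toNNReal ω :=
    measurable_eval_of_rightCont hY.right_cont hY.measurable_X hT.ennreal_toNNReal
  -- The set form of the strong Markov property is an identity of measures; integrating `F` against
  -- both sides gives the claim.
  have key : ((Y.P x).restrict {ω | T ω < ⊤}).map (fun ω => Y.θ (T ω).toNNReal ω) =
      (((Y.P x).restrict {ω | T ω < ⊤}).map (fun ω => Y.X (T ω).toNNReal ω)).bind Y.P := by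
    ext Λ hΛ
    rw [Measure.map_apply hθ hΛ, Measure.restrict_apply (hθ hΛ),
      Measure.bind_apply hΛ Y.P.measurable.aemeasurable,
      lintegral_map (Y.P.measurable_coe hΛ) hX]
    have h := hY.strong_markov (Measure.dirac x) inferInstance T hTs Set.univ
      (fun t => by simpa using hTs t) Λ hΛ
    rw [law_dirac, Set.univ_inter, Set.inter_comm] at h
    refine h.trans (setLIntegral_congr_fun hset fun ω hω => ?_)
    have : T ω ≠ ⊤ := ne_of_lt hω
    simp [stopped, this]
  rw [← lintegral_map hF hθ, key, Measure.lintegral_bind Y.P.measurable.aemeasurable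
    hF.aemeasurable, lintegral_map (Measurable.lintegral_kernel hF) hX]

theorem IsHunt.exitTime_shift (hY : Y.IsHunt) {D : Set 𝒳} {ω : Ω} {t : ℝ≥0}
    (h : (t : ℝ≥0∞) ≤ Y.exitTime D ω) :
    Y.exitTime D ω = t + Y.exitTime D (Y.θ t ω) := by
  apply le_antisymm
  · simp only [exitTime, ENNReal.add_iInf, hY.shift]
    refine le_iInf₂ fun s hs => ?_
    exact (iInf₂_le (s + t) hs).trans (by push_cast; rw [add_comm])
  · refine le_iInf₂ fun s hs => ?_
    have hts : t ≤ s := by exact_mod_cast h.trans (iInf₂_le s hs)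
    have h2 : Y.exitTime D (Y.θ t ω) ≤ ((s - t : ℝ≥0) : ℝ≥0∞) :=
      iInf₂_le (s - t) (by rwa [hY.shift, tsub_add_cancel_of_le hts])
    calc (t : ℝ≥0∞) + Y.exitTime D (Y.θ t ω) ≤ t + ((s - t : ℝ≥0) : ℝ≥0∞) := by gcongr
      _ = s := by rw [← ENNReal.coe_add, add_tsub_cancel_of_le hts]

theorem exitTime_mono {D D' : Set 𝒳} (h : D ⊆ D') (ω : Ω) :
    Y.exitTime D ω ≤ Y.exitTime D' ω :=
  hitTime_anti (Set.compl_subset_compl.2 (Set.image_mono h)) ω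

theorem IsHunt.X_exitTime_notMem (hY : Y.IsHunt) {D : Set 𝒳} (hD : IsOpen D) {ω : Ω} {t : ℝ≥0}
    (h : Y.exitTime D ω = t) : Y.X t ω ∉ ((↑) : 𝒳 → OnePoint 𝒳) '' D := by
  have hm := hY.stopped_hitTime_mem_closure (O := (((↑) : 𝒳 → OnePoint 𝒳) '' D)ᶜ) (ω := ω)
    (by rw [← exitTime_eq_hitTime, h]; exact ENNReal.coe_lt_top)
  rw [(OnePoint.isOpen_image_coe.2 hD).isClosed_compl.closure_eq] at hm
  rwa [stopped_of_eq (T := Y.hitTime (((↑) : 𝒳 → OnePoint 𝒳) '' D)ᶜ) (t := t) h] at hm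

theorem X_mem_of_lt_exitTime {D : Set 𝒳} {ω : Ω} {t : ℝ≥0} (h : (t : ℝ≥0∞) < Y.exitTime D ω) :
    Y.X t ω ∈ ((↑) : 𝒳 → OnePoint 𝒳) '' D := by
  by_contra hc
  exact absurd (hitTime_le (O := (((↑) : 𝒳 → OnePoint 𝒳) '' D)ᶜ) hc) (not_le.2 h)

/-- Always `τ_U ≤ τ_D`. Equality at a finite time would put the path outside the open set `D` by
right continuity, and at infinite time the stopped position is the cemetery. -/
theorem IsHunt.stopped_exitTime_mem_iff (hY : Y.IsHunt) {U D : Set 𝒳} (hD : IsOpen D)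
    (h : U ⊆ D) (ω : Ω) :
    Y.stopped (Y.exitTime U) ω ∈ ((↑) : 𝒳 → OnePoint 𝒳) '' D ↔
      Y.exitTime U ω < Y.exitTime D ω := by
  rcases eq_or_ne (Y.exitTime U ω) ⊤ with ht | ht
  · simp [stopped, ht]
  obtain ⟨t, ht⟩ : ∃ t : ℝ≥0, (t : ℝ≥0∞) = Y.exitTime U ω := ⟨_, ENNReal.coe_toNNReal ht⟩
  rw [stopped_of_eq ht.symm, ← ht]
  refine ⟨fun hm => lt_of_le_of_ne (ht.trans_le (exitTime_mono h ω)) fun he => ?_,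
    X_mem_of_lt_exitTime⟩
  exact hY.X_exitTime_notMem hD he.symm hm

/-- Almost surely, the path does not come back from the cemetery by a jump. -/
theorem IsHunt.ae_eq_infty_of_leftLim [TopologicalSpace.PseudoMetrizableSpace (OnePoint 𝒳)]
    (hY : Y.IsHunt) (x : OnePoint 𝒳) :
    ∀ᵐ ω ∂(Y.P x), ∀ t : ℝ≥0, 0 < t →
      Tendsto (fun s => Y.X s ω) (𝓝[<] t) (𝓝 OnePoint.infty) → Y.X t ω = OnePoint.infty := by
  -- The exit time of the whole space is the lifetime. A left limit at `∞` forces its measurable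
  -- version to be at most `t`, and the cemetery is a trap.
  obtain ⟨T, -, -, -, hae, hT⟩ := hY.exists_isStopping_ae_eq_exitTime (W := Set.univ) isOpen_univ
  have := hae (Measure.dirac x) inferInstance
  rw [law_dirac] at this
  filter_upwards [this] with ω hω t ht hlim
  have hle := hT ω t _ ht hlim OnePoint.infty_notMem_image_coe
  rw [hω] at hle
  obtain ⟨s, hs⟩ : ∃ s : ℝ≥0, (s : ℝ≥0∞) = Y.exitTime Set.univ ω :=
    ⟨_, ENNReal.coe_toNNReal (hle.trans_lt ENNReal.coe_lt_top).ne⟩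
  have hinf : Y.X s ω = OnePoint.infty := by
    have := hY.X_exitTime_notMem isOpen_univ hs.symm
    rwa [Set.image_univ, OnePoint.notMem_range_coe_iff] at this
  exact hY.trap ω s t (by rw [← hs] at hle; exact_mod_cast hle) hinf

/-- Just before the exit the path is in `W`, so its left limit is in the closure of `W` in the
compactification; the value `∞` is excluded because the path would then be dead at the exit. -/
theorem IsHunt.ae_leftLim_exitTime_mem [TopologicalSpace.PseudoMetrizableSpace (OnePoint 𝒳)]
    [T2Space (OnePoint 𝒳)]
    (hY : Y.IsHunt) {x : 𝒳} {W A : Set 𝒳} (hW : IsOpen W) (hA : IsClosed A) (hWA : W ⊆ A)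
    (hx : x ∈ W) :
    ∀ᵐ ω ∂(Y.P x), ∀ t : ℝ≥0, Y.exitTime W ω = t → Y.X t ω ≠ OnePoint.infty →
      Function.leftLim (fun s => Y.X s ω) t ∈ ((↑) : 𝒳 → OnePoint 𝒳) '' A := by
  filter_upwards [hY.ae_eq_infty_of_leftLim x, hY.normal x] with ω hinf h0 t ht hne
  -- The path starts in `W` and is outside `W` at its exit time, so the exit is not at time `0`,
  -- where `leftLim` is no true limit.
  have ht0 : 0 < t := by
    rw [pos_iff_ne_zero]
    rintro rfl
    exact hY.X_exitTime_notMem hW ht (h0 ▸ ⟨x, hx, rfl⟩)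
  obtain ⟨z, hz⟩ := hY.left_lim ω t ht0
  have hnb : NeBot (𝓝[<] t) := nhdsLT_neBot_of_exists_lt ⟨0, ht0⟩
  rw [leftLim_eq_of_tendsto hz]
  have hcl : z ∈ closure (((↑) : 𝒳 → OnePoint 𝒳) '' W) := by
    refine mem_closure_of_tendsto hz ?_
    filter_upwards [self_mem_nhdsWithin] with s hs
    exact X_mem_of_lt_exitTime (by rw [ht]; exact_mod_cast hs)
  induction z using OnePoint.rec with
  | infty => exact absurd (hinf t ht0 hz) hne
  | coe y =>
    refine ⟨y, ?_, rfl⟩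
    rw [← hA.closure_eq]
    have : y ∈ closure W := by
      rw [OnePoint.isOpenEmbedding_coe.isInducing.closure_eq_preimage_closure_image]
      exact hcl
    exact closure_mono hWA this

end

end ProcessData

end HuntBHP

/-! ### Lévy system estimate and the one-step inequality -/

namespace HuntBHP

theorem volume_setOf_ofReal_le (a : ℝ≥0∞) :
    (volume : Measure ℝ) {s : ℝ | 0 ≤ s ∧ ENNReal.ofReal s ≤ a} ≤ a := by
  rcases eq_or_ne a ⊤ with rfl | ha
  · exact le_top
  calc (volume : Measure ℝ) {s : ℝ | 0 ≤ s ∧ ENNReal.ofReal s ≤ a}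
      ≤ volume (Set.Icc 0 a.toReal) :=
        measure_mono fun s hs => ⟨hs.1, (ENNReal.ofReal_le_iff_le_toReal ha).1 hs.2⟩
    _ = a := by rw [Real.volume_Icc, sub_zero, ENNReal.ofReal_toReal ha]

namespace ProcessData

variable {𝒳 : Type u} [TopologicalSpace 𝒳] {Ω : Type v} [MeasurableSpace Ω]
  {Y : ProcessData 𝒳 Ω}

/-- The probability that the process jumps from `A` into `G` at a stopping time is at most the
expected time multiplied by the supremum over `A` of the jump rates into `G`. -/
theorem IsLevySystem.measure_jump_le [MeasurableSpace 𝒳] {J : Kernel 𝒳 𝒳}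
    (hJ : Y.IsLevySystem J) {T : Ω → ℝ≥0∞} (hT : Measurable T) (hTs : Y.IsStopping T) {x : 𝒳} {A G : Set 𝒳}
    (hA : MeasurableSet A) (hG : MeasurableSet G) (hAG : Disjoint A G) {q : ℝ≥0∞}
    (hq : ∀ y ∈ A, J y G ≤ q) {E : Set Ω} (hE : MeasurableSet E)
    (hjump : ∀ᵐ ω ∂(Y.P x), ω ∈ E → ∃ t : ℝ≥0, T ω = t ∧
      Function.leftLim (fun s => Y.X s ω) t ∈ ((↑) : 𝒳 → OnePoint 𝒳) '' A ∧
      Y.X t ω ∈ ((↑) : 𝒳 → OnePoint 𝒳) '' G) :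
    Y.P x E ≤ q * ∫⁻ ω, T ω ∂(Y.P x) := by
  let f : ℝ≥0 × 𝒳 × 𝒳 → ℝ≥0∞ := fun p => (A ×ˢ G).indicator 1 p.2
  have hf : Measurable f :=
    ((measurable_one : Measurable (1 : 𝒳 × 𝒳 → ℝ≥0∞)).indicator (hA.prod hG)).comp measurable_snd
  have hf0 : ∀ s x, f (s, x, x) = 0 := fun s x =>
    Set.indicator_of_notMem (fun h => Set.disjoint_left.1 hAG h.1 h.2) _
  have h := hJ.2.2 f hf hf0 T hTs x
  calc Y.P x E = ∫⁻ ω, E.indicator 1 ω ∂(Y.P x) := (lintegral_indicator_one hE).symm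
    _ ≤ ∫⁻ ω, ∑' s : {s : ℝ≥0 // (s : ℝ≥0∞) ≤ T ω},
          (Function.leftLim (fun t => Y.X t ω) s.1).elim 0
            (fun y => (Y.X s.1 ω).elim 0 (fun z => f (s.1, y, z))) ∂(Y.P x) := by
        refine lintegral_mono_ae ?_
        filter_upwards [hjump] with ω hω
        by_cases hωE : ω ∈ E
        · obtain ⟨t, ht, ⟨y, hy, hyt⟩, ⟨z, hz, hzt⟩⟩ := hω hωE
          -- Of the whole sum over jumps only the term at time `T` is kept; it equals `1` on `E`.
          refine le_trans ?_ (ENNReal.le_tsum ⟨t, ht.ge⟩)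
          simp only [← hyt, ← hzt, OnePoint.elim_some]
          simp [f, hωE, hy, hz]
        · simp [hωE]
    _ = _ := h
    _ ≤ ∫⁻ ω, q * T ω ∂(Y.P x) := by
        refine lintegral_mono fun ω => ?_
        have hle : ∀ s : ℝ, (Y.X s.toNNReal ω).elim 0
            (fun y => ∫⁻ z, f (s.toNNReal, y, z) ∂(J y)) ≤ q := by
          intro s
          induction Y.X s.toNNReal ω using OnePoint.rec with
          | infty => simp
          | coe y =>
            rw [OnePoint.elim_some]
            by_cases hy : y ∈ A
            · have : (fun z => f (s.toNNReal, y, z)) = G.indicator 1 := by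
                funext z
                by_cases hz : z ∈ G <;> simp [f, hy, hz]
              rw [this, lintegral_indicator_one hG]
              exact hq y hy
            · have : ∀ z, f (s.toNNReal, y, z) = 0 := fun z => by simp [f, hy]
              simp only [this, lintegral_zero]
              exact bot_le
        calc _ ≤ ∫⁻ s in {s : ℝ | 0 ≤ s ∧ ENNReal.ofReal s ≤ T ω}, q ∂(volume : Measure ℝ) :=
              lintegral_mono fun s => hle s
          _ = q * (volume : Measure ℝ) {s : ℝ | 0 ≤ s ∧ ENNReal.ofReal s ≤ T ω} :=
              setLIntegral_const _ _
          _ ≤ q * T ω := by gcongr; exact volume_setOf_ofReal_le _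
    _ ≤ q * ∫⁻ ω, T ω ∂(Y.P x) := by
        rw [lintegral_const_mul _ hT]

section

variable [TopologicalSpace.PseudoMetrizableSpace (OnePoint 𝒳)]

theorem IsHunt.measure_shift (hY : Y.IsHunt) {T : Ω → ℝ≥0∞} (hT : Measurable T)
    (hTs : Y.IsStopping T) (x : OnePoint 𝒳) {Λ : Set Ω} (hΛ : MeasurableSet Λ) :
    Y.P x {ω | T ω < ⊤ ∧ Y.θ (T ω).toNNReal ω ∈ Λ} =
      ∫⁻ ω in {ω | T ω < ⊤}, Y.P (Y.X (T ω).toNNReal ω) Λ ∂(Y.P x) := by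
  have h := hY.lintegral_shift hT hTs x (measurable_one.indicator hΛ)
  simp only [lintegral_indicator_one hΛ] at h
  rw [← h]
  have hθ : MeasurableSet ((fun ω => Y.θ (T ω).toNNReal ω) ⁻¹' Λ) :=
    hY.measurable_shift hT.ennreal_toNNReal hΛ
  have h2 : (fun ω => Λ.indicator (1 : Ω → ℝ≥0∞) (Y.θ (T ω).toNNReal ω)) =
      ((fun ω => Y.θ (T ω).toNNReal ω) ⁻¹' Λ).indicator 1 := rfl
  rw [h2, lintegral_indicator_one hθ, Measure.restrict_apply hθ, Set.inter_comm]
  rfl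

/-- Properties that hold almost surely under all initial laws hold almost surely after a stopping
time. -/
theorem IsHunt.ae_shift (hY : Y.IsHunt) {T : Ω → ℝ≥0∞} (hT : Measurable T)
    (hTs : Y.IsStopping T) (x : OnePoint 𝒳) {p : Ω → Prop}
    (hp : ∀ μ : Measure (OnePoint 𝒳), IsProbabilityMeasure μ → ∀ᵐ ω ∂(Y.law μ), p ω) :
    ∀ᵐ ω ∂(Y.P x), T ω < ⊤ → p (Y.θ (T ω).toNNReal ω) := by
  have := hY.isMarkovKernel
  have hX : Measurable fun ω => Y.X (T ω).toNNReal ω :=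
    measurable_eval_of_rightCont hY.right_cont hY.measurable_X hT.ennreal_toNNReal
  -- The hypothesis is used for the law of the position at time `T` as initial distribution.
  obtain ⟨N, hpN, hN, hN0⟩ := exists_measurable_superset_of_null (ae_iff.1 (hp
    ((Y.P x).map fun ω => Y.X (T ω).toNNReal ω) (Measure.isProbabilityMeasure_map hX.aemeasurable)))
  have h0 : Y.P x {ω | T ω < ⊤ ∧ Y.θ (T ω).toNNReal ω ∈ N} = 0 := by
    rw [hY.measure_shift hT hTs x hN]
    refine le_antisymm (le_trans (setLIntegral_le_lintegral _ _) ?_) bot_le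
    rw [← lintegral_map (f := fun y => Y.P y N) (Y.P.measurable_coe hN) hX, ← hN0, law,
      Measure.bind_apply hN Y.P.measurable.aemeasurable]
  refine measure_mono_null (fun ω hω => ?_) h0
  have : ¬(T ω < ⊤ → p (Y.θ (T ω).toNNReal ω)) := hω
  push Not at this
  exact ⟨this.1, hpN this.2⟩

/-- On `{T < ∞}` the exit time of `U` is `T` plus the exit time of `U` by the path shifted by `T`;
then the strong Markov property applies. Expectations may be infinite, since nothing is subtracted.
-/
theorem IsHunt.lintegral_exitTime_add_le (hY : Y.IsHunt) {W U : Set 𝒳} (hU : IsOpen U)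
    (hWU : W ⊆ U) {T : Ω → ℝ≥0∞} (hT : Measurable T) (hTs : Y.IsStopping T) (x : OnePoint 𝒳)
    (hTW : ∀ᵐ ω ∂(Y.P x), T ω = Y.exitTime W ω) :
    ∫⁻ ω, T ω ∂(Y.P x) + ∫⁻ ω in {ω | T ω < ⊤},
        ∫⁻ ω', Y.exitTime U ω' ∂(Y.P (Y.X (T ω).toNNReal ω)) ∂(Y.P x) ≤
      ∫⁻ ω, Y.exitTime U ω ∂(Y.P x) := by
  obtain ⟨R, hR, -, hRle, hRae, -⟩ := hY.exists_isStopping_ae_eq_exitTime hU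
  have hRe : ∀ y : OnePoint 𝒳, ∫⁻ ω, Y.exitTime U ω ∂(Y.P y) = ∫⁻ ω, R ω ∂(Y.P y) := fun y => by
    have := hRae (Measure.dirac y) inferInstance
    rw [law_dirac] at this
    exact lintegral_congr_ae (this.mono fun ω h => h.symm)
  have hset : MeasurableSet {ω | T ω < ⊤} := hT measurableSet_Iio
  simp only [hRe]
  rw [← hY.lintegral_shift hT hTs x hR, ← lintegral_indicator hset, ← lintegral_add_left hT, ← hRe]
  refine lintegral_mono_ae ?_
  filter_upwards [hTW] with ω hω
  have hle := exitTime_mono (Y := Y) hWU ω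
  by_cases h : T ω < ⊤
  · have hc : ((T ω).toNNReal : ℝ≥0∞) = T ω := ENNReal.coe_toNNReal h.ne
    rw [Set.indicator_of_mem (show ω ∈ {ω | T ω < ⊤} from h),
      hY.exitTime_shift (t := (T ω).toNNReal) (D := U) (ω := ω) (by rw [hc, hω]; exact hle), hc]
    gcongr
    exact hRle _
  · rw [not_lt, top_le_iff] at h
    rw [← hω, h, top_le_iff] at hle
    rw [hle]
    exact le_top

/-- One step of the iteration for exit probabilities: a bound of the probability
`P_z(τ_U < τ_D)` by `Γ z + K E_z τ_U` is improved by the strong Markov property at the exit time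
`T` of a smaller set. -/
theorem IsHunt.measure_exitTime_lt_le (hY : Y.IsHunt) {W U D : Set 𝒳} (hU : IsOpen U)
    (hD : IsOpen D) (hWU : W ⊆ U)
    {T : Ω → ℝ≥0∞} (hT : Measurable T) (hTs : Y.IsStopping T) (x : OnePoint 𝒳)
    (hTW : ∀ᵐ ω ∂(Y.P x), T ω = Y.exitTime W ω)
    {Γ : OnePoint 𝒳 → ℝ≥0∞} (hΓ : Measurable Γ) {K a : ℝ≥0∞}
    (hbound : ∀ z ∈ D, Y.P z {ω | Y.exitTime U ω < Y.exitTime D ω} ≤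
      Γ z + K * ∫⁻ ω, Y.exitTime U ω ∂(Y.P z))
    (ha : ∫⁻ ω in {ω | T ω < ⊤}, Γ (Y.X (T ω).toNNReal ω) ∂(Y.P x) ≤
      a + K * ∫⁻ ω, T ω ∂(Y.P x)) :
    Y.P x {ω | Y.exitTime U ω < Y.exitTime D ω} ≤ a + K * ∫⁻ ω, Y.exitTime U ω ∂(Y.P x) := by
  obtain ⟨R, hR, -, -, hRae, -⟩ := hY.exists_isStopping_ae_eq_exitTime hU
  obtain ⟨Q, hQ, -, -, hQae, -⟩ := hY.exists_isStopping_ae_eq_exitTime hD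
  have hX : Measurable fun ω => Y.X (T ω).toNNReal ω :=
    measurable_eval_of_rightCont hY.right_cont hY.measurable_X hT.ennreal_toNNReal
  have hDm : MeasurableSet (((↑) : 𝒳 → OnePoint 𝒳) '' D) :=
    (OnePoint.isOpen_image_coe.2 hD).measurableSet
  -- `R` and `Q` are measurable versions of the exit times of `U` and `D`. Prescribing a start in
  -- `D` makes the event null under the other laws, so `hbound` is needed only on `D`.
  set Λ : Set Ω := {ω | R ω < Q ω} ∩ Y.X 0 ⁻¹' (((↑) : 𝒳 → OnePoint 𝒳) '' D) with hΛdef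
  have hΛ : MeasurableSet Λ := (measurableSet_lt hR hQ).inter (hY.measurable_X 0 hDm)
  have hRm : Measurable fun y : OnePoint 𝒳 => ∫⁻ ω, Y.exitTime U ω ∂(Y.P y) := by
    have : (fun y : OnePoint 𝒳 => ∫⁻ ω, Y.exitTime U ω ∂(Y.P y)) =
        fun y => ∫⁻ ω, R ω ∂(Y.P y) := by
      funext y
      have := hRae (Measure.dirac y) inferInstance
      rw [law_dirac] at this
      exact lintegral_congr_ae (this.mono fun ω h => h.symm)
    rw [this]
    exact hR.lintegral_kernel
  have hΛle : ∀ y : OnePoint 𝒳, Y.P y Λ ≤ Γ y + K * ∫⁻ ω, Y.exitTime U ω ∂(Y.P y) := by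
    intro y
    by_cases hy : y ∈ ((↑) : 𝒳 → OnePoint 𝒳) '' D
    · obtain ⟨z, hz, rfl⟩ := hy
      refine le_trans (measure_mono_ae ?_) (hbound z hz)
      have h1 := hRae (Measure.dirac z) inferInstance
      have h2 := hQae (Measure.dirac z) inferInstance
      rw [law_dirac] at h1 h2
      filter_upwards [h1, h2] with ω h1 h2 hω
      have : R ω < Q ω := hω.1
      rwa [h1, h2] at this
    · refine le_trans (le_of_eq ?_) bot_le
      refine measure_mono_null (fun ω hω => ?_) (ae_iff.1 (hY.normal y))
      intro h0
      exact hy (h0 ▸ hω.2)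
  calc Y.P x {ω | Y.exitTime U ω < Y.exitTime D ω}
      ≤ Y.P x {ω | T ω < ⊤ ∧ Y.θ (T ω).toNNReal ω ∈ Λ} := by
        refine measure_mono_ae ?_
        filter_upwards [hTW, hY.ae_shift hT hTs x hRae, hY.ae_shift hT hTs x hQae]
          with ω hω h1 h2 hlt
        have hlt : Y.exitTime U ω < Y.exitTime D ω := hlt
        have hle : T ω ≤ Y.exitTime U ω := hω ▸ exitTime_mono hWU ω
        have htop : T ω < ⊤ := hle.trans_lt (hlt.trans_le le_top)
        have hc : ((T ω).toNNReal : ℝ≥0∞) = T ω := ENNReal.coe_toNNReal htop.ne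
        refine ⟨htop, ?_, ?_⟩
        · show R _ < Q _
          rw [h1 htop, h2 htop]
          have hleD : T ω ≤ Y.exitTime D ω := hle.trans hlt.le
          rw [hY.exitTime_shift (t := (T ω).toNNReal) (D := U) (by rwa [hc]),
            hY.exitTime_shift (t := (T ω).toNNReal) (D := D) (by rwa [hc])] at hlt
          exact lt_of_add_lt_add_left hlt
        · rw [Set.mem_preimage, hY.shift, zero_add]
          exact X_mem_of_lt_exitTime (by rw [hc]; exact hle.trans_lt hlt)
    _ = ∫⁻ ω in {ω | T ω < ⊤}, Y.P (Y.X (T ω).toNNReal ω) Λ ∂(Y.P x) :=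
        hY.measure_shift hT hTs x hΛ
    _ ≤ ∫⁻ ω in {ω | T ω < ⊤}, (Γ (Y.X (T ω).toNNReal ω) +
          K * ∫⁻ ω', Y.exitTime U ω' ∂(Y.P (Y.X (T ω).toNNReal ω))) ∂(Y.P x) :=
        lintegral_mono fun ω => hΛle _
    _ = ∫⁻ ω in {ω | T ω < ⊤}, Γ (Y.X (T ω).toNNReal ω) ∂(Y.P x) +
          K * ∫⁻ ω in {ω | T ω < ⊤},
            ∫⁻ ω', Y.exitTime U ω' ∂(Y.P (Y.X (T ω).toNNReal ω)) ∂(Y.P x) := by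
        have h1 : Measurable fun ω => Γ (Y.X (T ω).toNNReal ω) := hΓ.comp hX
        have h2 : Measurable fun ω =>
            ∫⁻ ω', Y.exitTime U ω' ∂(Y.P (Y.X (T ω).toNNReal ω)) := hRm.comp hX
        rw [lintegral_add_left h1, lintegral_const_mul _ h2]
    _ ≤ a + K * ∫⁻ ω, T ω ∂(Y.P x) + K * ∫⁻ ω in {ω | T ω < ⊤},
            ∫⁻ ω', Y.exitTime U ω' ∂(Y.P (Y.X (T ω).toNNReal ω)) ∂(Y.P x) := by gcongr
    _ ≤ a + K * ∫⁻ ω, Y.exitTime U ω ∂(Y.P x) := by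
        rw [add_assoc, ← mul_add]
        gcongr
        exact hY.lintegral_exitTime_add_le hU hWU hT hTs x hTW

end

end ProcessData

end HuntBHP

/-! ### Leaving a small ball: exit probability and jump tail -/

namespace HuntBHP

theorem IsScale.pos {φ : ℝ≥0 → ℝ≥0} {c : ℝ≥0} {β : ℝ} (h : IsScale φ c β) {r : ℝ≥0}
    (hr : 0 < r) : 0 < φ r := by
  have := h.strictMono hr
  rwa [h.map_zero] at this

theorem IsScale.div_le {φ : ℝ≥0 → ℝ≥0} {c : ℝ≥0} {β : ℝ} (h : IsScale φ c β) {r : ℝ≥0}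
    (hr : 0 < r) (k : ℕ) : φ r / φ (r / 2 ^ k) ≤ c * ((2 : ℝ≥0) ^ β) ^ k := by
  have h1 := h.growth (r / 2 ^ k) r (by positivity)
    (div_le_self zero_le (one_le_pow₀ one_le_two))
  have h2 : r / (r / 2 ^ k) = 2 ^ k := by field_simp
  rw [h2] at h1
  rwa [← NNReal.rpow_natCast (2 ^ β), ← NNReal.rpow_mul, mul_comm β, NNReal.rpow_mul,
    NNReal.rpow_natCast]

variable {𝒳 : Type u} [MetricSpace 𝒳] {Ω : Type v} [MeasurableSpace Ω] {Y : ProcessData 𝒳 Ω}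

/-- A process that leaves `D ∩ B(x, ρ)` into `D` leaves `B(x, ρ)`, either early or late. -/
theorem ExitProbUpper.measure_exit_mem_le (hY : Y.IsHunt)
    {φ : ℝ≥0 → ℝ≥0} {r₀ : ℝ≥0∞} {CE : ℝ≥0} (hE : ExitProbUpper Y φ r₀ CE) {D : Set 𝒳}
    (hD : IsOpen D) {x : 𝒳} {ρ : ℝ≥0} (hρ : 0 < ρ) (hρr : (ρ : ℝ≥0∞) < r₀) {T : Ω → ℝ≥0∞}
    (hT : Measurable T) (hTW : ∀ᵐ ω ∂(Y.P x), T ω = Y.exitTime (D ∩ Metric.ball x ρ) ω)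
    {t : ℝ≥0} (ht : 0 < t) :
    Y.P x {ω | T ω < ⊤ ∧ Y.X (T ω).toNNReal ω ∈ ((↑) : 𝒳 → OnePoint 𝒳) '' D} ≤
      CE * (t / φ ρ) + (∫⁻ ω, T ω ∂(Y.P x)) / t := by
  calc _ ≤ Y.P x ({ω | Y.exitTime (Metric.ball x ρ) ω < t} ∪ {ω | (t : ℝ≥0∞) ≤ T ω}) := by
        refine measure_mono_ae ?_
        filter_upwards [hTW] with ω hω hωE
        obtain ⟨htop, hXD⟩ := hωE
        by_contra hcon
        have hcon' : ω ∉ {ω | Y.exitTime (Metric.ball x ρ) ω < t} ∪ {ω | (t : ℝ≥0∞) ≤ T ω} := hcon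
        simp only [Set.mem_union, Set.mem_ofPred_eq, not_or, not_lt, not_le] at hcon'
        have hc : ((T ω).toNNReal : ℝ≥0∞) = T ω := ENNReal.coe_toNNReal htop.ne
        have hlt : T ω < Y.exitTime (Metric.ball x ρ) ω := hcon'.2.trans_le hcon'.1
        have hXB := ProcessData.X_mem_of_lt_exitTime (Y := Y) (t := (T ω).toNNReal)
          (by rwa [hc])
        -- If the ball had not been left by time `T`, the position would be in both `D` and the
        -- ball, contrary to `T` being the exit time of their intersection.
        refine hY.X_exitTime_notMem (hD.inter Metric.isOpen_ball) (hω.symm.trans hc.symm) ?_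
        rw [Set.image_inter OnePoint.coe_injective]
        exact ⟨hXD, hXB⟩
    _ ≤ Y.P x {ω | Y.exitTime (Metric.ball x ρ) ω < t} + Y.P x {ω | (t : ℝ≥0∞) ≤ T ω} :=
        measure_union_le _ _
    _ ≤ _ := by
        gcongr
        · exact hE t ht x ρ hρ hρr
        · exact meas_ge_le_lintegral_div hT.aemeasurable (by simpa using ht.ne') ENNReal.coe_ne_top

/-- A process that leaves `D ∩ B(x, ρ)` to the outside of a larger ball does so by a jump. -/
theorem JumpTailUpper.measure_exit_mem_le [MeasurableSpace 𝒳] [BorelSpace 𝒳]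
    [TopologicalSpace.PseudoMetrizableSpace (OnePoint 𝒳)] [T2Space (OnePoint 𝒳)] (hY : Y.IsHunt)
    {J : Kernel 𝒳 𝒳} (hJ : Y.IsLevySystem J) {φ : ℝ≥0 → ℝ≥0} {rbar : ℝ≥0∞} {CJ : ℝ≥0}
    (hJt : JumpTailUpper J φ rbar CJ) {D G : Set 𝒳} (hD : IsOpen D) (hG : MeasurableSet G)
    {x : 𝒳} (hx : x ∈ D) {ρ ρ' : ℝ≥0} (hρ : 0 < ρ) (hρ' : 0 < ρ') (hρr : (ρ' : ℝ≥0∞) < rbar)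
    (hdist : ∀ z ∈ G, (ρ : ℝ) + ρ' ≤ dist z x)
    {T : Ω → ℝ≥0∞} (hT : Measurable T) (hTs : Y.IsStopping T)
    (hTW : ∀ᵐ ω ∂(Y.P x), T ω = Y.exitTime (D ∩ Metric.ball x ρ) ω) :
    Y.P x {ω | T ω < ⊤ ∧ Y.X (T ω).toNNReal ω ∈ ((↑) : 𝒳 → OnePoint 𝒳) '' G} ≤
      CJ / φ ρ' * ∫⁻ ω, T ω ∂(Y.P x) := by
  have hfar : ∀ y ∈ Metric.closedBall x (ρ : ℝ), ∀ z ∈ G, (ρ' : ℝ) ≤ dist z y := by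
    intro y hy z hz
    have h1 := hdist z hz
    have h2 := dist_triangle z y x
    have h3 := Metric.mem_closedBall.1 hy
    linarith
  refine hJ.measure_jump_le hT hTs (A := Metric.closedBall x (ρ : ℝ)) (G := G)
    Metric.isClosed_closedBall.measurableSet hG ?_ ?_ ?_ ?_
  · refine Set.disjoint_left.2 fun z hz hzG => ?_
    have := hfar z hz z hzG
    rw [dist_self] at this
    exact absurd this (not_le.2 (by exact_mod_cast hρ'))
  · intro y hy
    refine (measure_mono fun z hz => ?_).trans (hJt y ρ' hρ' hρr)
    exact fun h => not_le.2 (Metric.mem_ball.1 h) (hfar y hy z hz)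
  · have hX : Measurable fun ω => Y.X (T ω).toNNReal ω :=
      measurable_eval_of_rightCont hY.right_cont hY.measurable_X hT.ennreal_toNNReal
    exact (hT measurableSet_Iio).inter
      (hX (OnePoint.isOpenEmbedding_coe.measurableEmbedding.measurableSet_image.2 hG))
  · filter_upwards [hTW, hY.ae_leftLim_exitTime_mem (hD.inter Metric.isOpen_ball)
      Metric.isClosed_closedBall (Set.inter_subset_right.trans Metric.ball_subset_closedBall)
      (⟨hx, Metric.mem_ball_self (by exact_mod_cast hρ)⟩ : x ∈ D ∩ Metric.ball x (ρ : ℝ))]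
      with ω hω hl hωE
    obtain ⟨htop, hXG⟩ := hωE
    have hc : ((T ω).toNNReal : ℝ≥0∞) = T ω := ENNReal.coe_toNNReal htop.ne
    refine ⟨(T ω).toNNReal, hc.symm, hl _ (hω.symm.trans hc.symm) ?_, hXG⟩
    obtain ⟨z, -, hz⟩ := hXG
    rw [← hz]
    exact OnePoint.coe_ne_infty z

end HuntBHP

/-! ### Shells, weights and the iteration -/

namespace HuntBHP

/-- The radii that decrease geometrically from `r` to `r / 2`. -/
noncomputable def shellRadius (r : ℝ≥0) (j : ℕ) : ℝ := (r : ℝ) / 2 + r / 2 ^ (j + 1)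

theorem shellRadius_zero (r : ℝ≥0) : shellRadius r 0 = r := by
  simp [shellRadius]

theorem half_le_shellRadius (r : ℝ≥0) (j : ℕ) : (r : ℝ) / 2 ≤ shellRadius r j := by
  unfold shellRadius
  linarith [show (0 : ℝ) ≤ r / 2 ^ (j + 1) by positivity]

/-- Room for the jump: from the ball of radius `r / 2^(n+3)` about a point of the `(n+1)`-th ball,
the complement of the `j`-th ball is at distance at least `r / 2^(j+3)`. Equality holds for `j = n`,
as `1/4 + 1/8 + 1/8 = 1/2`. -/
theorem shellRadius_add_le (r : ℝ≥0) {j n : ℕ} (h : j ≤ n) :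
    shellRadius r (n + 1) + ((r / 2 ^ (n + 3) : ℝ≥0) : ℝ) + ((r / 2 ^ (j + 3) : ℝ≥0) : ℝ) ≤
      shellRadius r j := by
  have h1 : (r : ℝ) / 2 ^ n ≤ r / 2 ^ j :=
    div_le_div_of_nonneg_left r.2 (by positivity) (pow_le_pow_right₀ one_le_two h)
  have h2 : ∀ k m : ℕ, (r : ℝ) / 2 ^ (k + m) = r / 2 ^ k / 2 ^ m := fun k m => by
    rw [pow_add, div_div]
  unfold shellRadius
  push_cast
  rw [add_assoc n 1 1, h2 n, h2 n, h2 j, h2 j]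
  linarith

theorem sum_range_half_pow_le (n : ℕ) : ∑ j ∈ Finset.range n, ((1 : ℝ≥0) / 2) ^ j ≤ 2 := by
  have := sum_geometric_two_le n
  rw [← NNReal.coe_le_coe]
  push_cast
  exact this

/-- The weight of the point `z` in the `n`-th bound of the exit probability. -/
noncomputable def shellWeight {𝒳 : Type u} [MetricSpace 𝒳] (D : Set 𝒳) (ξ : 𝒳) (r γ : ℝ≥0) (n : ℕ)
    (z : OnePoint 𝒳) : ℝ≥0∞ :=
  ((γ⁻¹ ^ n : ℝ≥0) : ℝ≥0∞) * (((↑) : 𝒳 → OnePoint 𝒳) '' D).indicator 1 z +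
    ∑ j ∈ Finset.range (n + 1), ((γ * γ⁻¹ ^ j : ℝ≥0) : ℝ≥0∞) *
      (((↑) : 𝒳 → OnePoint 𝒳) '' (D \ Metric.ball ξ (shellRadius r j))).indicator 1 z

section

variable {𝒳 : Type u} [MetricSpace 𝒳]

theorem measurable_shellWeight {D : Set 𝒳} (hD : IsOpen D) (ξ : 𝒳) (r γ : ℝ≥0) (n : ℕ) :
    Measurable (shellWeight D ξ r γ n) := by
  borelize 𝒳
  have hm : ∀ G : Set 𝒳, MeasurableSet G → MeasurableSet (((↑) : 𝒳 → OnePoint 𝒳) '' G) :=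
    fun G hG => OnePoint.isOpenEmbedding_coe.measurableEmbedding.measurableSet_image.2 hG
  unfold shellWeight
  refine ((measurable_one.indicator (hm _ hD.measurableSet)).const_mul _).add
    (Finset.measurable_fun_sum _ fun j _ => ?_)
  exact (measurable_one.indicator
    (hm _ (hD.measurableSet.diff Metric.isOpen_ball.measurableSet))).const_mul _

variable {Ω : Type v} [MeasurableSpace Ω] {Y : ProcessData 𝒳 Ω}
  [TopologicalSpace.PseudoMetrizableSpace (OnePoint 𝒳)]

theorem lintegral_shellWeight {D : Set 𝒳} (hD : IsOpen D) (ξ : 𝒳) (r γ : ℝ≥0) (n : ℕ)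
    (hY : Y.IsHunt) (x : OnePoint 𝒳) {T : Ω → ℝ≥0∞} (hT : Measurable T) :
    ∫⁻ ω in {ω | T ω < ⊤}, shellWeight D ξ r γ n (Y.X (T ω).toNNReal ω) ∂(Y.P x) =
      ((γ⁻¹ ^ n : ℝ≥0) : ℝ≥0∞) * Y.P x {ω | T ω < ⊤ ∧
        Y.X (T ω).toNNReal ω ∈ ((↑) : 𝒳 → OnePoint 𝒳) '' D} +
      ∑ j ∈ Finset.range (n + 1), ((γ * γ⁻¹ ^ j : ℝ≥0) : ℝ≥0∞) * Y.P x {ω | T ω < ⊤ ∧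
        Y.X (T ω).toNNReal ω ∈
          ((↑) : 𝒳 → OnePoint 𝒳) '' (D \ Metric.ball ξ (shellRadius r j))} := by
  borelize 𝒳
  have hX : Measurable fun ω => Y.X (T ω).toNNReal ω :=
    measurable_eval_of_rightCont hY.right_cont hY.measurable_X hT.ennreal_toNNReal
  have hm : ∀ G : Set 𝒳, MeasurableSet G → MeasurableSet (((↑) : 𝒳 → OnePoint 𝒳) '' G) :=
    fun G hG => OnePoint.isOpenEmbedding_coe.measurableEmbedding.measurableSet_image.2 hG
  have hi : ∀ G : Set 𝒳, MeasurableSet G → Measurable fun ω =>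
      (((↑) : 𝒳 → OnePoint 𝒳) '' G).indicator (1 : OnePoint 𝒳 → ℝ≥0∞) (Y.X (T ω).toNNReal ω) :=
    fun G hG => (measurable_one.indicator (hm G hG)).comp hX
  have hint : ∀ G : Set 𝒳, MeasurableSet G → ∫⁻ ω in {ω | T ω < ⊤},
      (((↑) : 𝒳 → OnePoint 𝒳) '' G).indicator (1 : OnePoint 𝒳 → ℝ≥0∞) (Y.X (T ω).toNNReal ω)
        ∂(Y.P x) = Y.P x {ω | T ω < ⊤ ∧
          Y.X (T ω).toNNReal ω ∈ ((↑) : 𝒳 → OnePoint 𝒳) '' G} := by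
    intro G hG
    have hG' := hX (hm G hG)
    have h2 : (fun ω => (((↑) : 𝒳 → OnePoint 𝒳) '' G).indicator (1 : OnePoint 𝒳 → ℝ≥0∞)
        (Y.X (T ω).toNNReal ω)) = ((fun ω => Y.X (T ω).toNNReal ω) ⁻¹'
          (((↑) : 𝒳 → OnePoint 𝒳) '' G)).indicator 1 := rfl
    rw [h2, lintegral_indicator_one hG', Measure.restrict_apply hG', Set.inter_comm]
    rfl
  have hDj : ∀ j, MeasurableSet (D \ Metric.ball ξ (shellRadius r j)) := fun j =>
    hD.measurableSet.diff Metric.isOpen_ball.measurableSet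
  unfold shellWeight
  rw [lintegral_add_left ((hi D hD.measurableSet).const_mul _),
    lintegral_const_mul _ (hi D hD.measurableSet), hint D hD.measurableSet,
    lintegral_finsetSum _ fun j _ => (hi _ (hDj j)).const_mul _]
  congr 1
  refine Finset.sum_congr rfl fun j _ => ?_
  rw [lintegral_const_mul _ (hi _ (hDj j)), hint _ (hDj j)]

variable [MeasurableSpace 𝒳] [BorelSpace 𝒳] [T2Space (OnePoint 𝒳)]

/-- The expected weight at the exit from a small ball is controlled by the expected exit time. -/
theorem lintegral_shellWeight_exit_le (hY : Y.IsHunt) {J : Kernel 𝒳 𝒳} (hJ : Y.IsLevySystem J)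
    {φ : ℝ≥0 → ℝ≥0} {c CE CJ : ℝ≥0} (hc : 1 ≤ c) {β : ℝ} (hβ : 0 < β) (hCE : 0 < CE)
    (hφ : IsScale φ c β)
    {r₀ rbar : ℝ≥0∞} (hE : ExitProbUpper Y φ r₀ CE) (hJt : JumpTailUpper J φ rbar CJ)
    {D : Set 𝒳} (hD : IsOpen D) {ξ : 𝒳} {r : ℝ≥0} (hr : 0 < r) (hrr : (r : ℝ≥0∞) < min r₀ rbar)
    {γ M : ℝ≥0} (hγ : γ = 2 * 2 ^ β) (hM : M = c * (2 ^ β) ^ 3) {n : ℕ} {x : 𝒳} (hx : x ∈ D)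
    (hxn : x ∈ Metric.ball ξ (shellRadius r (n + 1))) {T : Ω → ℝ≥0∞} (hT : Measurable T)
    (hTs : Y.IsStopping T)
    (hTW : ∀ᵐ ω ∂(Y.P x), T ω =
      Y.exitTime (D ∩ Metric.ball x ((r / 2 ^ (n + 3) : ℝ≥0) : ℝ)) ω) :
    ∫⁻ ω in {ω | T ω < ⊤}, shellWeight D ξ r γ n (Y.X (T ω).toNNReal ω) ∂(Y.P x) ≤
      ((γ⁻¹ ^ (n + 1) : ℝ≥0) : ℝ≥0∞) +
        (((γ * M * CE + 2 * γ * M * CJ) / φ r : ℝ≥0) : ℝ≥0∞) * ∫⁻ ω, T ω ∂(Y.P x) := by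
  have hb : (1 : ℝ≥0) ≤ 2 ^ β := NNReal.one_le_rpow one_le_two hβ.le
  have hb0 : (0 : ℝ≥0) < 2 ^ β := zero_lt_one.trans_le hb
  have hγ0 : 0 < γ := by rw [hγ]; positivity
  have hM0 : 0 < M := by rw [hM]; have := zero_lt_one.trans_le hc; positivity
  have hφr : 0 < φ r := hφ.pos hr
  have hρpos : ∀ k : ℕ, 0 < r / 2 ^ k := fun k => by positivity
  have hρlt : ∀ k : ℕ, ((r / 2 ^ k : ℝ≥0) : ℝ≥0∞) < min r₀ rbar := fun k =>
    lt_of_le_of_lt (ENNReal.coe_le_coe.2 (div_le_self zero_le (one_le_pow₀ one_le_two))) hrr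
  -- `M` collects the growth constant `c` and the three extra halvings.
  have hscale : ∀ j : ℕ, φ r / φ (r / 2 ^ (j + 3)) ≤ M * (2 ^ β) ^ j := fun j =>
    (hφ.div_le hr _).trans_eq (by rw [hM]; ring)
  -- The factor `2 ^ β` in `γ` cancels the growth of the scale; the other factor `2` makes the shell
  -- sum geometric.
  have hγb : ∀ j : ℕ, γ⁻¹ ^ j * (2 ^ β) ^ j = (1 / 2) ^ j := fun j => by
    rw [← mul_pow, hγ]
    congr 1
    field_simp
  rw [lintegral_shellWeight hD ξ r γ n hY x hT]
  -- the part that stays in the ball of the current radius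
  have h1 : ((γ⁻¹ ^ n : ℝ≥0) : ℝ≥0∞) * Y.P x {ω | T ω < ⊤ ∧
        Y.X (T ω).toNNReal ω ∈ ((↑) : 𝒳 → OnePoint 𝒳) '' D} ≤
      ((γ⁻¹ ^ (n + 1) : ℝ≥0) : ℝ≥0∞) +
        ((γ * M * CE / φ r : ℝ≥0) : ℝ≥0∞) * ∫⁻ ω, T ω ∂(Y.P x) := by
    -- This level makes the late-exit coefficient `γ⁻¹ ^ n / t` independent of `n`, while the
    -- early-exit term still gains a full factor `γ⁻¹` (`ha`).
    obtain ⟨t, htdef⟩ : ∃ t : ℝ≥0, t = γ⁻¹ ^ n * φ r / (γ * M * CE) := ⟨_, rfl⟩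
    have ht : 0 < t := by rw [htdef]; positivity
    have ha : γ⁻¹ ^ n * (CE * (t / φ (r / 2 ^ (n + 3)))) ≤ γ⁻¹ ^ (n + 1) := by
      have : γ⁻¹ ^ n * (CE * (t / φ (r / 2 ^ (n + 3)))) =
          γ⁻¹ ^ (n + 1) * (γ⁻¹ ^ n * (φ r / φ (r / 2 ^ (n + 3))) / M) := by
        rw [htdef, pow_succ γ⁻¹ n]
        generalize γ⁻¹ ^ n = p
        field_simp
      rw [this]
      refine mul_le_of_le_one_right zero_le ?_
      rw [div_le_one hM0]
      calc γ⁻¹ ^ n * (φ r / φ (r / 2 ^ (n + 3))) ≤ γ⁻¹ ^ n * (M * (2 ^ β) ^ n) := by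
            gcongr; exact hscale n
        _ = M * (1 / 2) ^ n := by rw [← hγb]; ring
        _ ≤ M := mul_le_of_le_one_right zero_le (pow_le_one₀ zero_le (by norm_num))
    have hd : γ⁻¹ ^ n * t⁻¹ = γ * M * CE / φ r := by
      rw [htdef]
      field_simp
    calc _ ≤ ((γ⁻¹ ^ n : ℝ≥0) : ℝ≥0∞) * (CE * (t / φ (r / 2 ^ (n + 3))) +
          (∫⁻ ω, T ω ∂(Y.P x)) / t) := by
            gcongr
            exact hE.measure_exit_mem_le hY hD (hρpos _) ((hρlt _).trans_le (min_le_left _ _))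
              hT hTW ht
      _ = ((γ⁻¹ ^ n * (CE * (t / φ (r / 2 ^ (n + 3)))) : ℝ≥0) : ℝ≥0∞) +
          ((γ⁻¹ ^ n * t⁻¹ : ℝ≥0) : ℝ≥0∞) * ∫⁻ ω, T ω ∂(Y.P x) := by
            have := hφ.pos (hρpos (n + 3))
            push_cast [ENNReal.coe_div this.ne', ENNReal.coe_inv ht.ne']
            rw [mul_add, div_eq_mul_inv (∫⁻ ω, T ω ∂(Y.P x))]
            ring
      _ ≤ _ := by rw [hd]; gcongr
  -- the jumps to the outer shells
  have h2 : ∀ j ∈ Finset.range (n + 1), ((γ * γ⁻¹ ^ j : ℝ≥0) : ℝ≥0∞) * Y.P x {ω | T ω < ⊤ ∧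
        Y.X (T ω).toNNReal ω ∈
          ((↑) : 𝒳 → OnePoint 𝒳) '' (D \ Metric.ball ξ (shellRadius r j))} ≤
      ((γ * M * CJ / φ r * (1 / 2) ^ j : ℝ≥0) : ℝ≥0∞) * ∫⁻ ω, T ω ∂(Y.P x) := by
    intro j hj
    have hjn : j ≤ n := Nat.lt_succ_iff.1 (Finset.mem_range.1 hj)
    have hφj := hφ.pos (hρpos (j + 3))
    have hdist : ∀ z ∈ D \ Metric.ball ξ (shellRadius r j),
        ((r / 2 ^ (n + 3) : ℝ≥0) : ℝ) + ((r / 2 ^ (j + 3) : ℝ≥0) : ℝ) ≤ dist z x := by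
      intro z hz
      have h1 : shellRadius r j ≤ dist z ξ := not_lt.1 hz.2
      have h2 := Metric.mem_ball.1 hxn
      have h3 := dist_triangle z x ξ
      have h4 := shellRadius_add_le r hjn
      linarith
    have hle : γ * γ⁻¹ ^ j * (CJ / φ (r / 2 ^ (j + 3))) ≤ γ * M * CJ / φ r * (1 / 2) ^ j := by
      have : γ * γ⁻¹ ^ j * (CJ / φ (r / 2 ^ (j + 3))) =
          γ * CJ / φ r * (γ⁻¹ ^ j * (φ r / φ (r / 2 ^ (j + 3)))) := by
        field_simp
      rw [this]
      calc _ ≤ γ * CJ / φ r * (γ⁻¹ ^ j * (M * (2 ^ β) ^ j)) := by gcongr; exact hscale j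
        _ = γ * CJ / φ r * M * (γ⁻¹ ^ j * (2 ^ β) ^ j) := by ring
        _ = _ := by rw [hγb]; ring
    calc _ ≤ ((γ * γ⁻¹ ^ j : ℝ≥0) : ℝ≥0∞) *
          (CJ / φ (r / 2 ^ (j + 3)) * ∫⁻ ω, T ω ∂(Y.P x)) := by
            gcongr
            exact hJt.measure_exit_mem_le hY hJ hD
              (hD.measurableSet.diff Metric.isOpen_ball.measurableSet) hx (hρpos _) (hρpos _)
              ((hρlt _).trans_le (min_le_right _ _)) hdist hT hTs hTW
      _ = ((γ * γ⁻¹ ^ j * (CJ / φ (r / 2 ^ (j + 3))) : ℝ≥0) : ℝ≥0∞) * ∫⁻ ω, T ω ∂(Y.P x) := by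
            rw [← mul_assoc, ← ENNReal.coe_div hφj.ne', ← ENNReal.coe_mul]
      _ ≤ _ := by gcongr
  calc _ ≤ ((γ⁻¹ ^ (n + 1) : ℝ≥0) : ℝ≥0∞) +
        ((γ * M * CE / φ r : ℝ≥0) : ℝ≥0∞) * ∫⁻ ω, T ω ∂(Y.P x) +
        ∑ j ∈ Finset.range (n + 1),
          ((γ * M * CJ / φ r * (1 / 2) ^ j : ℝ≥0) : ℝ≥0∞) * ∫⁻ ω, T ω ∂(Y.P x) :=
        add_le_add h1 (Finset.sum_le_sum h2)
    _ = ((γ⁻¹ ^ (n + 1) : ℝ≥0) : ℝ≥0∞) +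
        ((γ * M * CE / φ r + γ * M * CJ / φ r * ∑ j ∈ Finset.range (n + 1), (1 / 2) ^ j : ℝ≥0) :
          ℝ≥0∞) * ∫⁻ ω, T ω ∂(Y.P x) := by
        rw [← Finset.sum_mul, ← ENNReal.ofNNReal_finsetSum, ← Finset.mul_sum, add_assoc, ← add_mul,
          ← ENNReal.coe_add]
    _ ≤ _ := by
        gcongr
        calc γ * M * CE / φ r + γ * M * CJ / φ r * ∑ j ∈ Finset.range (n + 1), (1 / 2) ^ j
            ≤ γ * M * CE / φ r + γ * M * CJ / φ r * 2 := by
              gcongr; exact sum_range_half_pow_le _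
          _ = (γ * M * CE + 2 * γ * M * CJ) / φ r := by ring

/-- The induction covers all starting points in `D`, not only those near `ξ`, since the path may
land anywhere in `D` when it leaves the small ball. -/
theorem measure_exitTime_lt_le_shellWeight (hY : Y.IsHunt) {J : Kernel 𝒳 𝒳}
    (hJ : Y.IsLevySystem J)
    {φ : ℝ≥0 → ℝ≥0} {c CE CJ : ℝ≥0} (hc : 1 ≤ c) {β : ℝ} (hβ : 0 < β) (hCE : 0 < CE)
    (hφ : IsScale φ c β)
    {r₀ rbar : ℝ≥0∞} (hE : ExitProbUpper Y φ r₀ CE) (hJt : JumpTailUpper J φ rbar CJ)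
    {D : Set 𝒳} (hD : IsOpen D) {ξ : 𝒳} {r : ℝ≥0} (hr : 0 < r) (hrr : (r : ℝ≥0∞) < min r₀ rbar)
    {γ M : ℝ≥0} (hγ : γ = 2 * 2 ^ β) (hM : M = c * (2 ^ β) ^ 3) (n : ℕ) :
    ∀ z ∈ D, Y.P z {ω | Y.exitTime (D ∩ Metric.ball ξ r) ω < Y.exitTime D ω} ≤
      shellWeight D ξ r γ n z + (((γ * M * CE + 2 * γ * M * CJ) / φ r : ℝ≥0) : ℝ≥0∞) *
        ∫⁻ ω, Y.exitTime (D ∩ Metric.ball ξ r) ω ∂(Y.P z) := by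
  have hMk := hY.isMarkovKernel
  have hb : (1 : ℝ≥0) ≤ 2 ^ β := NNReal.one_le_rpow one_le_two hβ.le
  have hγ0 : γ ≠ 0 := by rw [hγ]; positivity
  have hweight : ∀ n (z : 𝒳), z ∈ D → ((γ⁻¹ ^ n : ℝ≥0) : ℝ≥0∞) ≤ shellWeight D ξ r γ n z := by
    intro n z hz
    refine le_trans (le_of_eq ?_) le_self_add
    simp [hz]
  induction n with
  | zero =>
    intro z hz
    refine le_trans prob_le_one (le_trans ?_ le_self_add)
    simpa using hweight 0 z hz
  | succ n ih =>
    intro z hz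
    by_cases hzn : z ∈ Metric.ball ξ (shellRadius r (n + 1))
    · have hsub : D ∩ Metric.ball z ((r / 2 ^ (n + 3) : ℝ≥0) : ℝ) ⊆ D ∩ Metric.ball ξ r := by
        refine Set.inter_subset_inter_right _ (Metric.ball_subset_ball' ?_)
        have h1 := shellRadius_add_le r (Nat.zero_le n)
        rw [shellRadius_zero] at h1
        have h2 := Metric.mem_ball.1 hzn
        have h3 : (0 : ℝ) ≤ ((r / 2 ^ (0 + 3) : ℝ≥0) : ℝ) := NNReal.coe_nonneg _
        linarith
      obtain ⟨T, hT, hTs, -, hTae, -⟩ := hY.exists_isStopping_ae_eq_exitTime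
        (hD.inter (Metric.isOpen_ball (x := z) (ε := ((r / 2 ^ (n + 3) : ℝ≥0) : ℝ))))
      have hTW := hTae (Measure.dirac z) inferInstance
      rw [ProcessData.law_dirac] at hTW
      refine (hY.measure_exitTime_lt_le (hD.inter Metric.isOpen_ball) hD hsub hT hTs z hTW
        (measurable_shellWeight hD ξ r γ n) ih
        (lintegral_shellWeight_exit_le hY hJ hc hβ hCE hφ hE hJt hD hr hrr hγ hM hz hzn hT hTs
          hTW)).trans ?_
      gcongr
      exact hweight _ z hz
    · refine (ih z hz).trans ?_
      gcongr
      -- Off the `(n+1)`-th ball nothing needs improving: the new shell term has the weight `γ⁻¹ ^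
      -- n` of the old term on `D`, so the weight does not decrease.
      have hpow : γ * γ⁻¹ ^ (n + 1) = γ⁻¹ ^ n := by
        rw [pow_succ]
        field_simp
      have hmem : z ∈ D \ Metric.ball ξ (shellRadius r (n + 1)) := ⟨hz, hzn⟩
      unfold shellWeight
      rw [Finset.sum_range_succ _ (n + 1), hpow,
        Set.indicator_of_mem (Set.mem_image_of_mem _ hz),
        Set.indicator_of_mem (Set.mem_image_of_mem _ hmem), add_comm]
      exact le_add_self

end

end HuntBHP

/-! ### Passage to the limit in the iteration -/

theorem proposition3p1 (c : ℝ≥0) (β : ℝ) (CE CJ : ℝ≥0)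
    (hc : 1 ≤ c) (hβ : 0 < β) (hCE : 0 < CE) (hCJ : 0 < CJ) :
    ∃ C : ℝ≥0, 1 ≤ C ∧
      ∀ (𝒳 : Type u) [MetricSpace 𝒳] [LocallyCompactSpace 𝒳]
        [TopologicalSpace.SeparableSpace 𝒳] [MeasurableSpace 𝒳] [BorelSpace 𝒳]
        (Ω : Type v) [MeasurableSpace Ω] (Y : HuntBHP.ProcessData 𝒳 Ω) (J : Kernel 𝒳 𝒳)
        (φ : ℝ≥0 → ℝ≥0) (r₀ rbar : ℝ≥0∞),
        Y.IsHunt → Y.IsLevySystem J → HuntBHP.IsScale φ c β → 0 < r₀ → 0 < rbar →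
        HuntBHP.ExitProbUpper Y φ r₀ CE → HuntBHP.JumpTailUpper J φ rbar CJ →
        ∀ (D : Set 𝒳), IsOpen D → ∀ (ξ : 𝒳) (r : ℝ≥0), 0 < r → (r : ℝ≥0∞) < min r₀ rbar →
        ∀ x ∈ D ∩ Metric.ball ξ ((r : ℝ) / 2),
          Y.P x {ω | Y.stopped (Y.exitTime (D ∩ Metric.ball ξ r)) ω ∈
              ((↑) : 𝒳 → OnePoint 𝒳) '' D} =
            Y.P x {ω | Y.exitTime (D ∩ Metric.ball ξ r) ω < Y.exitTime D ω} ∧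
          Y.P x {ω | Y.exitTime (D ∩ Metric.ball ξ r) ω < Y.exitTime D ω} ≤
            (C : ℝ≥0∞) * ((∫⁻ ω, Y.exitTime (D ∩ Metric.ball ξ r) ω ∂(Y.P x)) / φ r) := by
  obtain ⟨γ, hγ⟩ : ∃ γ : ℝ≥0, γ = 2 * 2 ^ β := ⟨_, rfl⟩
  obtain ⟨M, hM⟩ : ∃ M : ℝ≥0, M = c * (2 ^ β) ^ 3 := ⟨_, rfl⟩
  refine ⟨max 1 (γ * M * CE + 2 * γ * M * CJ), le_max_left _ _, ?_⟩
  intro 𝒳 _ _ _ _ _ Ω _ Y J φ r₀ rbar hY hJ hφ _ _ hE hJt D hD ξ r hr hrr x hx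
  have : SecondCountableTopology 𝒳 := UniformSpace.secondCountable_of_separable 𝒳
  have : TopologicalSpace.MetrizableSpace (OnePoint 𝒳) :=
    TopologicalSpace.metrizableSpace_of_t3_secondCountable _
  refine ⟨by simp only [hY.stopped_exitTime_mem_iff hD Set.inter_subset_left], ?_⟩
  have hφr := hφ.pos hr
  have hγ1 : γ⁻¹ < 1 := by
    refine inv_lt_one_of_one_lt₀ ?_
    rw [hγ]
    have : (1 : ℝ≥0) ≤ 2 ^ β := NNReal.one_le_rpow one_le_two hβ.le
    exact lt_mul_of_lt_of_one_le one_lt_two this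
  have hbound : ∀ n : ℕ, Y.P x {ω | Y.exitTime (D ∩ Metric.ball ξ r) ω < Y.exitTime D ω} ≤
      ((γ⁻¹ ^ n : ℝ≥0) : ℝ≥0∞) + (((γ * M * CE + 2 * γ * M * CJ) / φ r : ℝ≥0) : ℝ≥0∞) *
        ∫⁻ ω, Y.exitTime (D ∩ Metric.ball ξ r) ω ∂(Y.P x) := by
    intro n
    refine (HuntBHP.measure_exitTime_lt_le_shellWeight hY hJ hc hβ hCE hφ hE hJt hD hr hrr hγ hM n x
      hx.1).trans_eq ?_
    congr 1
    -- All the radii are at least `r / 2`, so every shell term vanishes at `x` and only `γ⁻¹ ^ n`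
    -- remains.
    have hmem : ∀ j, x ∉ D \ Metric.ball ξ (HuntBHP.shellRadius r j) := fun j h =>
      h.2 (Metric.ball_subset_ball (HuntBHP.half_le_shellRadius r j) hx.2)
    have hsum : ∀ j, (((↑) : 𝒳 → OnePoint 𝒳) '' (D \ Metric.ball ξ (HuntBHP.shellRadius r j))).indicator
        (1 : OnePoint 𝒳 → ℝ≥0∞) x = 0 := fun j =>
      Set.indicator_of_notMem (fun h => hmem j (OnePoint.coe_injective.mem_set_image.1 h)) _
    unfold HuntBHP.shellWeight
    simp only [hsum, mul_zero, Finset.sum_const_zero, add_zero,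
      Set.indicator_of_mem (Set.mem_image_of_mem _ hx.1), Pi.one_apply, mul_one]
  have hlim : Tendsto (fun n : ℕ => ((γ⁻¹ ^ n : ℝ≥0) : ℝ≥0∞) +
      (((γ * M * CE + 2 * γ * M * CJ) / φ r : ℝ≥0) : ℝ≥0∞) *
        ∫⁻ ω, Y.exitTime (D ∩ Metric.ball ξ r) ω ∂(Y.P x)) atTop
      (𝓝 (0 + (((γ * M * CE + 2 * γ * M * CJ) / φ r : ℝ≥0) : ℝ≥0∞) *
        ∫⁻ ω, Y.exitTime (D ∩ Metric.ball ξ r) ω ∂(Y.P x))) := by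
    refine Tendsto.add ?_ tendsto_const_nhds
    have h := ENNReal.tendsto_coe.2 (tendsto_pow_atTop_nhds_zero_of_lt_one zero_le hγ1)
    rwa [ENNReal.coe_zero] at h
  refine (ge_of_tendsto' hlim hbound).trans ?_
  rw [zero_add, ENNReal.coe_div hφr.ne', div_eq_mul_inv, div_eq_mul_inv, mul_assoc,
    mul_comm (φ r : ℝ≥0∞)⁻¹]
  gcongr
  exact le_max_right _ _
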